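/- Let $\omega(x)=e^{-x^2}$, let $H_m(x)=\frac{(-1)^m}{\omega(x)}\frac{\mathrm d^m\omega(x)}{\mathrm dx^m}$ be the Hermite polynomials, and let $\|g\|_{L^2_\omega(\mathbb R)}=\left(\int_{\mathbb R}|g(x)|^2\omega(x)\,\mathrm dx\right)^{1/2}$. Let $\rho>0$ and $\sigma\in\mathbb R$, let $\mathcal S_\rho=\{z\in\mathbb C:\ -\rho\le \Im z\le\rho\}$, and let $f$ be analytic at every point of $\mathcal S_\rho$. Suppose that there are constants $C,R$ with $|f(z)|\le C|z|^\sigma$ for all $z\in\mathcal S_\rho$ with $|z|\ge R$. Put \[ V=\int_{\partial\mathcal S_\rho}\bigl|e^{-z^2/2}f(z)\bigr|\,|\mathrm dz| =\int_{\mathbb R}\bigl|e^{-(x+\mathrm i\rho)^2/2}f(x+\mathrm i\rho)\bigr|\,\mathrm dx+\int_{\mathbb R}\bigl|e^{-(x-\mathrm i\rho)^2/2}f(x-\mathrm i\rho)\bigr|\,\mathrm dx . \] Then $V<\infty$, and there is a sequence of real numbers $(\mathcal K_n)_{n\ge 0}$ (depending on $f,\rho,\sigma$) with \[ \lim_{n\to\infty}\mathcal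 K_n=\frac{V}{2^{1/4}\rho\sqrt{\pi}} \] such that, for every integer $n\ge\max\{\lfloor\sigma\rfloor,1\}$, there is exactly one polynomial $p_n$ of degree at most $n$ with $p_n(x)=f(x)$ at all real zeros $x$ of $H_{n+1}$, and it satisfies \[ \|f-p_n\|_{L^2_\omega(\mathbb R)}\le \mathcal K_n\, n^{1/4}\,e^{-\rho\sqrt{2n}} . \] -/

import Mathlib

open Filter Topology MeasureTheory

namespace HermiteInterp

/-- The closed infinite strip of all complex `z` with `-ρ ≤ Im z ≤ ρ`. -/
def strip (ρ : ℝ) : Set ℂ := {z : ℂ | z.im ∈ Set.Icc (-ρ) ρ}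

/-- The Hermite weight `ω(x) = exp(-x²)`. -/
noncomputable def weight (x : ℝ) : ℝ := Real.exp (-x ^ 2)

/-- The (physicists') Hermite polynomial, as a function on the real line, by Rodrigues' formula. -/
noncomputable def hermiteH (n : ℕ) (x : ℝ) : ℝ :=
  (-1) ^ n / weight x * iteratedDeriv n weight x

/-- The measure `ω(x) dx`; the norm of `L²_ω(ℝ)` is the `L²` norm of this measure. -/
noncomputable def weightMeasure : Measure ℝ :=
  volume.withDensity fun x => ENNReal.ofReal (weight x)

/-- `p` has degree at most `n` and agrees with `f` at all (real) zeros of `H_{n+1}`. -/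
def IsHermiteInterpolant (f : ℂ → ℂ) (n : ℕ) (p : Polynomial ℂ) : Prop :=
  p.degree ≤ n ∧ ∀ x : ℝ, hermiteH (n + 1) x = 0 → p.eval (x : ℂ) = f x

/-- The function `|exp(-z²/2) f(z)|` along the horizontal line `Im z = c`. -/
noncomputable def lineDensity (f : ℂ → ℂ) (c : ℝ) (x : ℝ) : ℝ :=
  ‖Complex.exp (-((x : ℂ) + c * Complex.I) ^ 2 / 2) * f ((x : ℂ) + c * Complex.I)‖

/-- The arc length integral of `|exp(-z²/2) f(z)|` over the boundary of the strip, that is, over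
the two lines `Im z = ρ` and `Im z = -ρ`. -/
noncomputable def boundaryV (f : ℂ → ℂ) (ρ : ℝ) : ℝ :=
  (∫ x : ℝ, lineDensity f ρ x) + ∫ x : ℝ, lineDensity f (-ρ) x

end HermiteInterp

/-!
The interpolation error has the contour integral representation
`f(x) - p(x) = Hₙ₊₁(x) / (2πi) ∫ f(z) / (Hₙ₊₁(z) (z - x)) dz` over the boundary of the strip, and
`|z - x| ≥ ρ` there. Hence the error in `L²_ω` is at most `‖Hₙ₊₁‖ / (2πρ)` times the integral of
`|f / Hₙ₊₁|` over the two boundary lines (`norm_sub_interpolant_le`), and the asymptotic size of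
`Hₙ₊₁` on these lines remains to be found.

The representation is obtained without residues. The function `f - p` is divisible by the nodal
polynomial, so that a divided difference of the quotient is holomorphic on the strip, and Cauchy's
theorem applies to it (`integral_lineDiff_eq_zero`). By partial fractions it differs from
`2ⁿ⁺¹ f / (Hₙ₊₁ (z - x))` by multiples of `1 / (z - a)` with real `a`, each of which contributes
`2πi`. That all zeros of `Hₙ` are real and simple follows from the three-term recurrence: in the
upper half-plane the quotients `Hₖ₊₁ / Hₖ` have positive imaginary part.

The lower bounds for `|Hₙ|` rest on three facts.
* The Hermite function `u(z) = exp(-z²/2) Hₙ(z)` satisfies `u'' = (z² - (2n + 1)) u`. Along a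
  vertical line `|u|²` therefore satisfies a differential inequality, and for `q = 2n + 1 - x² > 0`
  the amplitude `u(x)² + u'(x)² / q` is multiplied by at least about `sinh² (√q y)` at height `y`
  (`sinh_sq_le_of_vertical_ode`).
* By Sonin's argument this amplitude is least at `x = 0` (`soninFun_zero_le`), where it is known
  explicitly in terms of factorials.
* For `|z|² ≥ 2n` the recurrence gives `|Hₙ(z)| ≥ |z|ⁿ` (`norm_pow_le_norm_hermitePoly`).

Together these bounds give a pointwise asymptotic lower bound for `|u(x ± iρ)|`
(`tendsto_max_one_hermiteScale_div`) and a uniform one (`exists_hermiteScale_mul_le`) that allows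
for dominated convergence (`exists_tendsto_integral_line`). Stirling's formula for `‖Hₙ₊₁‖` and for
the amplitude at the origin then yields the constant (`tendsto_sqrt_amplitudeRatio`).
-/

namespace HermiteInterp
open Polynomial

/-! ### Hermite polynomials over a ring -/

/-- The physicists' Hermite polynomials over a commutative ring, defined by
`H₀ = 1` and `Hₙ₊₁ = 2 X Hₙ - Hₙ'`. -/
noncomputable def hermitePoly (R : Type*) [CommRing R] : ℕ → R[X]
  | 0 => 1
  | n + 1 => 2 * X * hermitePoly R n - derivative (hermitePoly R n)

section Algebra

variable {R S : Type*} [CommRing R] [CommRing S]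

@[simp] lemma hermitePoly_zero : hermitePoly R 0 = 1 := rfl

lemma hermitePoly_succ (n : ℕ) :
    hermitePoly R (n + 1) = 2 * X * hermitePoly R n - derivative (hermitePoly R n) := rfl

@[simp] lemma hermitePoly_one : hermitePoly R 1 = 2 * X := by
  simp [hermitePoly_succ]

lemma derivative_hermitePoly_succ (n : ℕ) :
    derivative (hermitePoly R (n + 1)) = 2 * ((n : R[X]) + 1) * hermitePoly R n := by
  induction n with
  | zero => simp
  | succ n ih =>
    rw [hermitePoly_succ (n + 1), derivative_sub, derivative_mul, ih]
    have h2 : derivative (2 * ((n : R[X]) + 1) * hermitePoly R n)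
        = 2 * ((n : R[X]) + 1) * derivative (hermitePoly R n) := by
      rw [derivative_mul]; simp
    rw [h2]
    have h3 : derivative (2 * X : R[X]) = 2 := by simp
    rw [h3]
    have h4 := hermitePoly_succ (R := R) n
    push_cast
    linear_combination (-(2 * ((n : R[X]) + 1))) * h4

lemma hermitePoly_add_two (n : ℕ) :
    hermitePoly R (n + 2) =
      2 * X * hermitePoly R (n + 1) - 2 * ((n : R[X]) + 1) * hermitePoly R n := by
  rw [hermitePoly_succ (n + 1), derivative_hermitePoly_succ]

lemma map_hermitePoly (φ : R →+* S) (n : ℕ) :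
    (hermitePoly R n).map φ = hermitePoly S n := by
  induction n with
  | zero => simp
  | succ n ih =>
    simp [hermitePoly_succ, ← ih]

lemma eval_hermitePoly_add_two (n : ℕ) (z : R) :
    (hermitePoly R (n + 2)).eval z =
      2 * z * (hermitePoly R (n + 1)).eval z - 2 * ((n : R) + 1) * (hermitePoly R n).eval z := by
  simp [hermitePoly_add_two]

lemma eval_derivative_hermitePoly_succ (n : ℕ) (z : R) :
    (derivative (hermitePoly R (n + 1))).eval z =
      2 * ((n : R) + 1) * (hermitePoly R n).eval z := by
  simp [derivative_hermitePoly_succ]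

/-- Hermite's differential equation `H'' - 2 z H' + 2 n H = 0`. -/
lemma eval_derivative_derivative_hermitePoly (n : ℕ) (z : R) :
    (derivative (derivative (hermitePoly R n))).eval z =
      2 * z * (derivative (hermitePoly R n)).eval z - 2 * n * (hermitePoly R n).eval z := by
  have h := derivative_hermitePoly_succ (R := R) n
  rw [hermitePoly_succ] at h
  have := congrArg (eval z) h
  simp at this
  linear_combination -this

lemma natDegree_hermitePoly_le (n : ℕ) : (hermitePoly R n).natDegree ≤ n := by
  induction n with
  | zero => simp
  | succ n ih =>
    rw [hermitePoly_succ]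
    refine (natDegree_sub_le _ _).trans (max_le ?_ ?_)
    · have h1 : (2 * X : R[X]).natDegree ≤ 1 := by
        rw [← C_ofNat]; exact (natDegree_C_mul_le _ _).trans natDegree_X_le
      have := natDegree_mul_le (p := (2 * X : R[X])) (q := hermitePoly R n)
      omega
    · have := natDegree_derivative_le (hermitePoly R n)
      omega

lemma coeff_hermitePoly_self (n : ℕ) : (hermitePoly R n).coeff n = 2 ^ n := by
  induction n with
  | zero => simp
  | succ n ih =>
    rw [hermitePoly_succ, coeff_sub, coeff_derivative,
      coeff_eq_zero_of_natDegree_lt (p := hermitePoly R n) (n := n + 1 + 1)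
        (by have := natDegree_hermitePoly_le (R := R) n; omega)]
    have : (2 * X * hermitePoly R n : R[X]) = C 2 * (hermitePoly R n * X) := by
      rw [← C_ofNat]; ring
    rw [this, coeff_C_mul, coeff_mul_X, ih]
    ring

end Algebra

lemma natDegree_hermitePoly (n : ℕ) : (hermitePoly ℂ n).natDegree = n :=
  natDegree_eq_of_le_of_coeff_ne_zero (natDegree_hermitePoly_le n)
    (by rw [coeff_hermitePoly_self]; exact pow_ne_zero _ two_ne_zero)

lemma hermitePoly_ne_zero (n : ℕ) : hermitePoly ℂ n ≠ 0 := fun h => by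
  have := coeff_hermitePoly_self (R := ℂ) n
  rw [h, coeff_zero] at this
  exact pow_ne_zero n two_ne_zero this.symm

lemma leadingCoeff_hermitePoly (n : ℕ) : (hermitePoly ℂ n).leadingCoeff = 2 ^ n := by
  rw [leadingCoeff, natDegree_hermitePoly, coeff_hermitePoly_self]

lemma eval_ofReal_hermitePoly (n : ℕ) (x : ℝ) :
    (hermitePoly ℂ n).eval (x : ℂ) = ((hermitePoly ℝ n).eval x : ℝ) := by
  rw [← map_hermitePoly Complex.ofRealHom, eval_map, ← Complex.ofRealHom_eq_coe x, eval₂_at_apply]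
  rfl

lemma eval_conj_hermitePoly (n : ℕ) (z : ℂ) :
    (hermitePoly ℂ n).eval (starRingEnd ℂ z) = starRingEnd ℂ ((hermitePoly ℂ n).eval z) := by
  conv_lhs => rw [← map_hermitePoly (starRingEnd ℂ), eval_map, eval₂_at_apply]

lemma weight_pos (x : ℝ) : 0 < weight x := Real.exp_pos _

lemma hasDerivAt_weight (x : ℝ) : HasDerivAt weight (-(2 * x) * weight x) x := by
  have h : HasDerivAt (fun x : ℝ => -x ^ 2) (-(2 * x)) x := by
    simpa using (hasDerivAt_pow 2 x).fun_neg
  have := h.exp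
  rw [mul_comm]
  exact this

lemma iteratedDeriv_weight (n : ℕ) (x : ℝ) :
    iteratedDeriv n weight x = (-1) ^ n * (hermitePoly ℝ n).eval x * weight x := by
  induction n generalizing x with
  | zero => simp
  | succ n ih =>
    rw [iteratedDeriv_succ, funext ih]
    have h := ((((hermitePoly ℝ n).hasDerivAt x).const_mul ((-1) ^ n)).mul (hasDerivAt_weight x))
    have h2 := h.deriv
    refine h2.trans ?_
    rw [hermitePoly_succ]
    simp
    ring

/-- The Rodrigues formula agrees with the recursive definition. -/
lemma hermiteH_eq_eval (n : ℕ) (x : ℝ) : hermiteH n x = (hermitePoly ℝ n).eval x := by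
  have hw := (weight_pos x).ne'
  rw [hermiteH, iteratedDeriv_weight]
  have : ((-1 : ℝ) ^ n) * (-1) ^ n = 1 := by rw [← mul_pow]; simp
  field_simp
  linear_combination (eval x (hermitePoly ℝ n)) * this

/-! ### Zeros and growth of Hermite polynomials -/

/-- In the upper half-plane the quotients `Hₙ₊₁ / Hₙ` have positive imaginary part, because
`r ↦ 2 z - 2 n / r` maps the upper half-plane to itself. -/
lemma im_hermitePoly_div_pos {z : ℂ} (hz : 0 < z.im) (n : ℕ) :
    (hermitePoly ℂ n).eval z ≠ 0 ∧
      0 < ((hermitePoly ℂ (n + 1)).eval z / (hermitePoly ℂ n).eval z).im := by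
  induction n with
  | zero => simp [hz]
  | succ n ih =>
    obtain ⟨h0, h1⟩ := ih
    set r := (hermitePoly ℂ (n + 1)).eval z / (hermitePoly ℂ n).eval z with hr
    have hne : (hermitePoly ℂ (n + 1)).eval z ≠ 0 := by
      intro h
      rw [h] at hr
      simp [hr] at h1
    refine ⟨hne, ?_⟩
    have e : (hermitePoly ℂ (n + 1 + 1)).eval z / (hermitePoly ℂ (n + 1)).eval z
        = 2 * z - ((2 * ((n : ℝ) + 1) : ℝ) : ℂ) * r⁻¹ := by
      rw [hr, eval_hermitePoly_add_two]
      push_cast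
      field_simp
    have hr0 : 0 < Complex.normSq r := Complex.normSq_pos.mpr (fun h => by simp [h] at h1)
    rw [e, Complex.sub_im, Complex.im_ofReal_mul, Complex.inv_im]
    have h2 : (2 * z).im = 2 * z.im := by simp
    have h3 : 0 < 2 * ((n : ℝ) + 1) * (r.im / Complex.normSq r) := by positivity
    rw [h2, neg_div]
    linarith

lemma eval_hermitePoly_ne_zero {z : ℂ} (hz : z.im ≠ 0) (n : ℕ) :
    (hermitePoly ℂ n).eval z ≠ 0 := by
  rcases lt_or_gt_of_ne hz with h | h
  · have h' : 0 < (starRingEnd ℂ z).im := by simpa using h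
    have := (im_hermitePoly_div_pos h' n).1
    rw [eval_conj_hermitePoly] at this
    exact fun h0 => this (by simp [h0])
  · exact (im_hermitePoly_div_pos h n).1

/-- Consecutive Hermite polynomials have no common zero. -/
lemma eval_hermitePoly_succ_ne_zero_of_eval_eq_zero {n : ℕ} {z : ℂ}
    (h : (hermitePoly ℂ (n + 1)).eval z = 0) : (hermitePoly ℂ n).eval z ≠ 0 := by
  induction n with
  | zero => simp
  | succ n ih =>
    intro h0
    rw [eval_hermitePoly_add_two, h0] at h
    have : 2 * ((n : ℂ) + 1) ≠ 0 := mul_ne_zero two_ne_zero (Nat.cast_add_one_ne_zero n)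
    simp [this] at h
    exact ih h0 h

/-- The set of zeros of `Hₙ`, as complex numbers. -/
noncomputable def hermiteNodes (n : ℕ) : Finset ℂ := (hermitePoly ℂ n).roots.toFinset

lemma mem_hermiteNodes {n : ℕ} {a : ℂ} :
    a ∈ hermiteNodes n ↔ (hermitePoly ℂ n).eval a = 0 := by
  simp [hermiteNodes, hermitePoly_ne_zero]

lemma im_eq_zero_of_mem_hermiteNodes {n : ℕ} {a : ℂ} (ha : a ∈ hermiteNodes n) : a.im = 0 := by
  by_contra h
  exact eval_hermitePoly_ne_zero h n (mem_hermiteNodes.mp ha)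

lemma nodup_roots_hermitePoly (n : ℕ) : (hermitePoly ℂ n).roots.Nodup := by
  refine Multiset.nodup_iff_count_le_one.mpr fun a => ?_
  rw [count_roots]
  by_contra! h
  obtain ⟨h1, h0⟩ := (one_lt_rootMultiplicity_iff_isRoot (hermitePoly_ne_zero n)).mp h
  rcases n with _ | n
  · simp at h1
  · rw [IsRoot, eval_derivative_hermitePoly_succ] at h0
    have h2 : 2 * ((n : ℂ) + 1) ≠ 0 := mul_ne_zero two_ne_zero (Nat.cast_add_one_ne_zero n)
    exact eval_hermitePoly_succ_ne_zero_of_eval_eq_zero h1 ((mul_eq_zero.mp h0).resolve_left h2)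

lemma eval_hermitePoly_eq_prod (n : ℕ) (z : ℂ) :
    (hermitePoly ℂ n).eval z = 2 ^ n * ∏ a ∈ hermiteNodes n, (z - a) := by
  have h := (IsAlgClosed.splits (hermitePoly ℂ n)).eval_eq_prod_roots z
  rw [h, leadingCoeff_hermitePoly, Finset.prod, hermiteNodes, Multiset.toFinset_val,
    (nodup_roots_hermitePoly n).dedup]

lemma card_hermiteNodes (n : ℕ) : (hermiteNodes n).card = n := by
  rw [hermiteNodes, Multiset.toFinset_card_of_nodup (nodup_roots_hermitePoly n),
    ← (IsAlgClosed.splits (hermitePoly ℂ n)).natDegree_eq_card_roots, natDegree_hermitePoly]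

/-- For `|z|² ≥ 2 n` the map `r ↦ 2 z - 2 k / r`, `k ≤ n`, preserves the condition `|r| ≥ |z|`, so
that all quotients of consecutive Hermite polynomials up to `Hₙ₊₁ / Hₙ` satisfy it. -/
lemma norm_mul_norm_hermitePoly_le {z : ℂ} {n : ℕ} (hz : 2 * (n : ℝ) ≤ ‖z‖ ^ 2) :
    ‖z‖ * ‖(hermitePoly ℂ n).eval z‖ ≤ ‖(hermitePoly ℂ (n + 1)).eval z‖ := by
  induction n with
  | zero =>
    have := norm_nonneg z
    simp
    linarith
  | succ n ih =>
    push_cast at hz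
    have h1 := ih (by linarith)
    rw [eval_hermitePoly_add_two]
    refine le_trans ?_ (norm_sub_norm_le _ _)
    have e : ‖2 * ((n : ℂ) + 1)‖ = 2 * ((n : ℝ) + 1) := by
      rw [← Nat.cast_succ, norm_mul, Complex.norm_natCast]; simp
    rw [norm_mul, norm_mul, norm_mul _ ((hermitePoly ℂ n).eval z), e, Complex.norm_ofNat]
    have h2 : 2 * ((n : ℝ) + 1) * ‖(hermitePoly ℂ n).eval z‖
        ≤ ‖z‖ * (‖z‖ * ‖(hermitePoly ℂ n).eval z‖) := by
      nlinarith [norm_nonneg ((hermitePoly ℂ n).eval z)]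
    have h3 := mul_le_mul_of_nonneg_left h1 (norm_nonneg z)
    linarith

lemma norm_pow_le_norm_hermitePoly {z : ℂ} {n : ℕ} (hz : 2 * (n : ℝ) ≤ ‖z‖ ^ 2) :
    ‖z‖ ^ n ≤ ‖(hermitePoly ℂ n).eval z‖ := by
  induction n with
  | zero => simp
  | succ n ih =>
    push_cast at hz
    have h1 := ih (by linarith)
    have h2 := norm_mul_norm_hermitePoly_le (z := z) (n := n) (by linarith)
    rw [pow_succ']
    exact (mul_le_mul_of_nonneg_left h1 (norm_nonneg z)).trans h2

/-! ### The weighted norm of Hermite polynomials -/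

lemma integrable_eval_mul_weight (p : ℝ[X]) : Integrable fun x : ℝ => p.eval x * weight x := by
  induction p using Polynomial.induction_on' with
  | add p q hp hq => exact (hp.add hq).congr (ae_of_all _ fun x => by simp [add_mul])
  | monomial n a =>
    have h := (integrable_rpow_mul_exp_neg_mul_sq (b := 1) one_pos (s := n)
      (by have := Nat.cast_nonneg (α := ℝ) n; linarith)).const_mul a
    simpa [weight, mul_assoc] using h

lemma integral_sq_hermitePoly_mul_weight (n : ℕ) :
    ∫ x : ℝ, (hermitePoly ℝ n).eval x ^ 2 * weight x = √Real.pi * 2 ^ n * n.factorial := by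
  induction n with
  | zero =>
    have := integral_gaussian 1
    simpa [weight] using this
  | succ n ih =>
    -- `Hₙ₊₁ ω = -(Hₙ ω)'` and `Hₙ₊₁' = 2 (n + 1) Hₙ`.
    have key := integral_mul_deriv_eq_deriv_mul_of_integrable
      (u := fun x => (hermitePoly ℝ (n + 1)).eval x)
      (u' := fun x => (derivative (hermitePoly ℝ (n + 1))).eval x)
      (v := fun x => (hermitePoly ℝ n).eval x * weight x)
      (v' := fun x => -((hermitePoly ℝ (n + 1)).eval x * weight x))
      (fun x _ => (hermitePoly ℝ (n + 1)).hasDerivAt x)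
      (fun x _ => by
        have h := ((hermitePoly ℝ n).hasDerivAt x).mul (hasDerivAt_weight x)
        refine h.congr_deriv ?_
        simp [hermitePoly_succ]
        ring)
      (by
        have := (integrable_eval_mul_weight (hermitePoly ℝ (n + 1) ^ 2)).neg
        refine this.congr (ae_of_all _ fun x => ?_)
        simp; ring)
      (by
        have := integrable_eval_mul_weight (derivative (hermitePoly ℝ (n + 1)) * hermitePoly ℝ n)
        refine this.congr (ae_of_all _ fun x => ?_)
        simp; ring)
      (by
        have := integrable_eval_mul_weight (hermitePoly ℝ (n + 1) * hermitePoly ℝ n)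
        refine this.congr (ae_of_all _ fun x => ?_)
        simp; ring)
    have e1 : ∀ x : ℝ, (hermitePoly ℝ (n + 1)).eval x ^ 2 * weight x =
        -((hermitePoly ℝ (n + 1)).eval x * -((hermitePoly ℝ (n + 1)).eval x * weight x)) := by
      intro x; ring
    have e2 : ∀ x : ℝ, (derivative (hermitePoly ℝ (n + 1))).eval x *
        ((hermitePoly ℝ n).eval x * weight x) =
        (2 * ((n : ℝ) + 1)) * ((hermitePoly ℝ n).eval x ^ 2 * weight x) := by
      intro x
      rw [eval_derivative_hermitePoly_succ]
      ring
    simp_rw [e1]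
    rw [integral_neg, key, neg_neg]
    simp_rw [e2]
    rw [integral_const_mul, ih, Nat.factorial_succ]
    push_cast
    ring

/-! ### Growth of solutions of `u'' = (z² - (2 n + 1)) u` along vertical lines -/

lemma monotoneOn_Icc_of_hasDerivAt {φ φ' : ℝ → ℝ} (hφ : ∀ t, HasDerivAt φ (φ' t) t) {Y : ℝ}
    (h : ∀ t, 0 ≤ t → t ≤ Y → 0 ≤ φ' t) : MonotoneOn φ (Set.Icc 0 Y) := by
  refine monotoneOn_of_deriv_nonneg (convex_Icc 0 Y)
    (fun t _ => (hφ t).continuousAt.continuousWithinAt)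
    (fun t _ => (hφ t).differentiableAt.differentiableWithinAt) fun t ht => ?_
  rw [interior_Icc] at ht
  rw [(hφ t).deriv]
  exact h t ht.1.le ht.2.le

lemma le_of_deriv_nonneg {φ φ' : ℝ → ℝ} (hφ : ∀ t, HasDerivAt φ (φ' t) t) {Y : ℝ}
    (hY : 0 ≤ Y) (h : ∀ t, 0 ≤ t → t ≤ Y → 0 ≤ φ' t) : φ 0 ≤ φ Y :=
  monotoneOn_Icc_of_hasDerivAt hφ h (Set.left_mem_Icc.mpr hY) (Set.right_mem_Icc.mpr hY) hY

/-- A function with `w'' ≥ κ² w - D` and `w'(0) = 0` dominates the solution of the corresponding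
equation: the Wronskian with `cosh (κ y)` is nonnegative. -/
lemma cosh_comparison {w a a' : ℝ → ℝ} {κ D Y : ℝ} (hκ : 0 < κ) (hY : 0 ≤ Y)
    (hw : ∀ y, HasDerivAt w (a y) y) (ha : ∀ y, HasDerivAt a (a' y) y) (ha0 : a 0 = 0)
    (h : ∀ y, 0 ≤ y → y ≤ Y → κ ^ 2 * w y - D ≤ a' y) :
    w 0 + (w 0 - D / κ ^ 2) * (Real.cosh (κ * Y) - 1) ≤ w Y := by
  have hlin : ∀ y, HasDerivAt (fun y : ℝ => κ * y) κ y := fun y => by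
    simpa using (hasDerivAt_id y).const_mul κ
  have hc : ∀ y, HasDerivAt (fun y => Real.cosh (κ * y)) (Real.sinh (κ * y) * κ) y :=
    fun y => (hlin y).cosh
  have hs : ∀ y, HasDerivAt (fun y => Real.sinh (κ * y)) (Real.cosh (κ * y) * κ) y :=
    fun y => (hlin y).sinh
  set w1 : ℝ → ℝ := fun y => w y - D / κ ^ 2 with hw1
  have hw1d : ∀ y, HasDerivAt w1 (a y) y := fun y => (hw y).sub_const _
  have hwr : ∀ y, 0 ≤ y → y ≤ Y →
      0 ≤ a y * Real.cosh (κ * y) - w1 y * (Real.sinh (κ * y) * κ) := by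
    intro y hy hyY
    have := le_of_deriv_nonneg
      (φ := fun y => a y * Real.cosh (κ * y) - w1 y * (Real.sinh (κ * y) * κ))
      (fun t => ((ha t).mul (hc t)).sub ((hw1d t).mul ((hs t).mul_const κ))) hy
      (fun t ht hty => by
        have h1 := h t ht (hty.trans hyY)
        have h2 : a' t - κ ^ 2 * w1 t ≥ 0 := by
          have : κ ^ 2 * w1 t = κ ^ 2 * w t - D := by
            simp only [hw1]; field_simp
          linarith
        have h3 := mul_nonneg h2 (Real.cosh_pos (κ * t)).le
        nlinarith [h3])
    simpa [ha0] using this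
  have hq := le_of_deriv_nonneg (φ := fun y => w1 y / Real.cosh (κ * y))
      (fun t => (hw1d t).div (hc t) (Real.cosh_pos _).ne') hY
      (fun t ht htY => div_nonneg (hwr t ht htY) (by positivity))
  have hcp := Real.cosh_pos (κ * Y)
  simp only [mul_zero, Real.cosh_zero, div_one] at hq
  rw [le_div_iff₀ hcp] at hq
  simp only [hw1] at hq
  linarith

/-- Let `U'' = (q + y² - 2 i x y) U` along a vertical line, and let `w = |U|²`, `a = Re (U' Ū)`, `v = |U'|²` and
`J = Im (U Ū')`; the hypotheses are the differential equations of these four functions. If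
`w'(0) = 0` then `w` increases, and at least like `sinh² (√q y)`, up to a factor that tends to `1`
as `q → ∞`. -/
lemma sinh_sq_le_of_vertical_ode {w a v J : ℝ → ℝ} {q x Y : ℝ} (hq : 0 < q) (hY : 0 ≤ Y)
    (hw : ∀ y, HasDerivAt w (2 * a y) y)
    (ha : ∀ y, HasDerivAt a (v y + (q + y ^ 2) * w y) y)
    (hv : ∀ y, HasDerivAt v (2 * (q + y ^ 2) * a y + 4 * x * y * J y) y)
    (hJ : ∀ y, HasDerivAt J (2 * x * y * w y) y)
    (hw0 : ∀ y, 0 ≤ w y) (hv0 : ∀ y, 0 ≤ v y) (ha0 : a 0 = 0) (hJ0 : J 0 ^ 2 ≤ w 0 * v 0) :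
    MonotoneOn w (Set.Icc 0 Y) ∧
    (w 0 + v 0 / q) * (1 - |x| * Y ^ 2 / √q) * Real.sinh (√q * Y) ^ 2 ≤ w Y := by
  have hapos : ∀ y, 0 ≤ y → 0 ≤ a y := fun y hy => by
    have := le_of_deriv_nonneg ha hy fun t _ _ =>
      add_nonneg (hv0 t) (mul_nonneg (by positivity) (hw0 t))
    rwa [ha0] at this
  refine ⟨monotoneOn_Icc_of_hasDerivAt hw fun t ht _ => mul_nonneg two_pos.le (hapos t ht), ?_⟩
  have hxJ : ∀ y, 0 ≤ y → x * J 0 ≤ x * J y := fun y hy =>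
    le_of_deriv_nonneg (φ := fun y => x * J y) (fun t => (hJ t).const_mul x) hy fun t ht _ => by
      have : x * (2 * x * t * w t) = 2 * x ^ 2 * t * w t := by ring
      rw [this]
      exact mul_nonneg (by positivity) (hw0 t)
  -- Only the mixed term `4 x y J` of `v'` can be negative, and `x J` is increasing.
  have hvlow : ∀ y, 0 ≤ y → v 0 + q * (w y - w 0) + 2 * (x * J 0) * y ^ 2 ≤ v y := by
    intro y hy
    have := le_of_deriv_nonneg (φ := fun y => v y - q * w y - 2 * (x * J 0) * y ^ 2)
      (fun t => ((hv t).sub ((hw t).const_mul q)).sub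
        ((hasDerivAt_pow 2 t).const_mul (2 * (x * J 0)))) hy (fun t ht _ => by
        have h1 := hxJ t ht
        have h2 : 0 ≤ 2 * t ^ 2 * a t := mul_nonneg (by positivity) (hapos t ht)
        have h3 : 0 ≤ 4 * t * (x * J t - x * J 0) := mul_nonneg (by positivity) (by linarith)
        have h4 : (2 * (q + t ^ 2) * a t + 4 * x * t * J t - q * (2 * a t) -
            2 * (x * J 0) * (((2 : ℕ) : ℝ) * t ^ (2 - 1))) =
            2 * t ^ 2 * a t + 4 * t * (x * J t - x * J 0) := by
          norm_num; ring
        rw [h4]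
        positivity)
    simp at this
    linarith
  have hqs : √q ^ 2 = q := Real.sq_sqrt hq.le
  have hqp : 0 < √q := Real.sqrt_pos.mpr hq
  have hcomp := cosh_comparison (κ := 2 * √q) (w := w) (a := fun y => 2 * a y)
    (D := 2 * (q * w 0 - v 0 + 2 * |x * J 0| * Y ^ 2)) (by positivity) hY hw
    (fun y => (ha y).const_mul 2) (by simp [ha0]) (fun y hy hyY => by
      have h1 := hvlow y hy
      have h2 : -(|x * J 0| * Y ^ 2) ≤ x * J 0 * y ^ 2 := by
        have h3 : y ^ 2 ≤ Y ^ 2 := by gcongr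
        have h4 := neg_abs_le (x * J 0)
        nlinarith [abs_nonneg (x * J 0), sq_nonneg y]
      have h5 : 0 ≤ y ^ 2 * w y := mul_nonneg (sq_nonneg y) (hw0 y)
      rw [mul_pow, hqs]
      linarith)
  refine le_trans ?_ hcomp
  have hcosh : Real.cosh (2 * √q * Y) - 1 = 2 * Real.sinh (√q * Y) ^ 2 := by
    rw [mul_assoc, Real.cosh_two_mul, Real.cosh_sq]; ring
  rw [hcosh, mul_pow, hqs]
  have hJabs : |J 0| ≤ √q * (w 0 + v 0 / q) / 2 := by
    refine abs_le_of_sq_le_sq ?_ ?_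
    · have h1 : (√q * (w 0 + v 0 / q) / 2) ^ 2 = q * (w 0 + v 0 / q) ^ 2 / 4 := by
        rw [div_pow, mul_pow, hqs]; norm_num
      rw [h1]
      refine hJ0.trans ?_
      have h2 : w 0 * v 0 = q * (w 0 * (v 0 / q)) := by field_simp
      rw [h2]
      nlinarith [sq_nonneg (w 0 - v 0 / q)]
    · have := hw0 0
      have := hv0 0
      positivity
  have hxJ0 : |x * J 0| * Y ^ 2 / q ≤ (w 0 + v 0 / q) / 2 * (|x| * Y ^ 2 / √q) := by
    rw [abs_mul]
    calc |x| * |J 0| * Y ^ 2 / q ≤ |x| * (√q * (w 0 + v 0 / q) / 2) * Y ^ 2 / q := by gcongr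
      _ = _ := by
        nth_rewrite 3 [← hqs]
        field_simp
  have hw00 := hw0 0
  have hsh := sq_nonneg (Real.sinh (√q * Y))
  have e : w 0 - 2 * (q * w 0 - v 0 + 2 * |x * J 0| * Y ^ 2) / (2 ^ 2 * q) =
      (w 0 + v 0 / q) / 2 - |x * J 0| * Y ^ 2 / q := by
    field_simp; ring
  rw [e]
  have : (w 0 + v 0 / q) / 2 * (1 - |x| * Y ^ 2 / √q) ≤
      (w 0 + v 0 / q) / 2 - |x * J 0| * Y ^ 2 / q := by linarith
  have := mul_le_mul_of_nonneg_right this hsh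
  linarith

/-! ### Lower bounds for Hermite functions -/

/-- The Hermite function `exp(-z²/2) Hₙ(z)`. -/
noncomputable def hermiteFun (n : ℕ) (z : ℂ) : ℂ :=
  Complex.exp (-z ^ 2 / 2) * (hermitePoly ℂ n).eval z

/-- The derivative of the Hermite function. -/
noncomputable def hermiteFunDeriv (n : ℕ) (z : ℂ) : ℂ :=
  Complex.exp (-z ^ 2 / 2) * ((derivative (hermitePoly ℂ n)).eval z - z * (hermitePoly ℂ n).eval z)

lemma hasDerivAt_cexp_neg_sq_div_two (z : ℂ) :
    HasDerivAt (fun z : ℂ => Complex.exp (-z ^ 2 / 2)) (Complex.exp (-z ^ 2 / 2) * -z) z := by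
  have h : HasDerivAt (fun z : ℂ => -z ^ 2 / 2) (-z) z := by
    have := ((hasDerivAt_pow 2 z).fun_neg).div_const 2
    refine this.congr_deriv ?_
    simp
    ring
  exact h.cexp

lemma hasDerivAt_hermiteFun (n : ℕ) (z : ℂ) :
    HasDerivAt (hermiteFun n) (hermiteFunDeriv n z) z := by
  have := (hasDerivAt_cexp_neg_sq_div_two z).mul ((hermitePoly ℂ n).hasDerivAt z)
  refine this.congr_deriv ?_
  rw [hermiteFunDeriv]
  ring

lemma hasDerivAt_hermiteFunDeriv (n : ℕ) (z : ℂ) :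
    HasDerivAt (hermiteFunDeriv n) ((z ^ 2 - (2 * n + 1)) * hermiteFun n z) z := by
  have := (hasDerivAt_cexp_neg_sq_div_two z).mul
    (((derivative (hermitePoly ℂ n)).hasDerivAt z).sub
      ((hasDerivAt_id z).mul ((hermitePoly ℂ n).hasDerivAt z)))
  refine this.congr_deriv ?_
  rw [hermiteFun, eval_derivative_derivative_hermitePoly]
  simp
  ring

/-- The function `u² + u'² / (2 n + 1 - x²)` for the Hermite function `u`, on the real axis. -/
noncomputable def soninFun (n : ℕ) (x : ℝ) : ℝ :=
  Real.exp (-x ^ 2) * ((hermitePoly ℝ n).eval x ^ 2 +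
    ((derivative (hermitePoly ℝ n)).eval x - x * (hermitePoly ℝ n).eval x) ^ 2 /
      (2 * n + 1 - x ^ 2))

lemma soninFun_zero (n : ℕ) : soninFun n 0 = (hermitePoly ℝ n).eval 0 ^ 2 +
    (derivative (hermitePoly ℝ n)).eval 0 ^ 2 / (2 * n + 1) := by
  simp [soninFun]

lemma soninFun_zero_nonneg (n : ℕ) : 0 ≤ soninFun n 0 := by
  rw [soninFun_zero]
  positivity

lemma hasDerivAt_soninFun (n : ℕ) {x : ℝ} (hx : x ^ 2 < 2 * n + 1) :
    HasDerivAt (soninFun n) (Real.exp (-x ^ 2) * (2 * x *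
      ((derivative (hermitePoly ℝ n)).eval x - x * (hermitePoly ℝ n).eval x) ^ 2 /
        (2 * n + 1 - x ^ 2) ^ 2)) x := by
  have hq : (2 * n + 1 - x ^ 2 : ℝ) ≠ 0 := by linarith
  have h0 : HasDerivAt (fun x : ℝ => Real.exp (-x ^ 2)) (-(2 * x) * Real.exp (-x ^ 2)) x :=
    hasDerivAt_weight x
  have h1 := (hermitePoly ℝ n).hasDerivAt x
  have h2 := ((derivative (hermitePoly ℝ n)).hasDerivAt x).sub ((hasDerivAt_id x).mul h1)
  have h3 := (hasDerivAt_pow 2 x).const_sub (2 * n + 1 : ℝ)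
  have := h0.mul ((h1.pow 2).add ((h2.pow 2).div h3 hq))
  refine this.congr_deriv ?_
  rw [eval_derivative_derivative_hermitePoly]
  simp
  field_simp
  ring

/-- Sonin's monotonicity: the amplitude of the Hermite function is least at the origin. -/
lemma soninFun_zero_le (n : ℕ) {x : ℝ} (hx : x ^ 2 < 2 * n + 1) :
    soninFun n 0 ≤ soninFun n x := by
  have hlt : ∀ t : ℝ, t ∈ Set.Icc (0 : ℝ) 1 → (t * x) ^ 2 < 2 * n + 1 := fun t ht => by
    have : t ^ 2 ≤ 1 := pow_le_one₀ ht.1 ht.2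
    rw [mul_pow]
    nlinarith [sq_nonneg x]
  have hd : ∀ t : ℝ, t ∈ Set.Icc (0 : ℝ) 1 →
      HasDerivAt (fun t => soninFun n (t * x)) (Real.exp (-(t * x) ^ 2) * (2 * (t * x) *
        ((derivative (hermitePoly ℝ n)).eval (t * x) -
          t * x * (hermitePoly ℝ n).eval (t * x)) ^ 2 /
            (2 * n + 1 - (t * x) ^ 2) ^ 2) * (1 * x)) t := fun t ht =>
    HasDerivAt.comp (h₂ := soninFun n) (h := fun t => t * x) t (hasDerivAt_soninFun n (hlt t ht))
      ((hasDerivAt_id' t).mul_const x)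
  have hm : MonotoneOn (fun t => soninFun n (t * x)) (Set.Icc 0 1) := by
    refine monotoneOn_of_deriv_nonneg (convex_Icc 0 1)
      (fun t ht => (hd t ht).continuousAt.continuousWithinAt)
      (fun t ht => (hd t (interior_subset ht)).differentiableAt.differentiableWithinAt)
      fun t ht => ?_
    have ht' := interior_subset ht
    rw [(hd t ht').deriv]
    have h0 := ht'.1
    have e : ∀ A B : ℝ, Real.exp (-(t * x) ^ 2) * (2 * (t * x) * A ^ 2 / B ^ 2) * (1 * x) =
        Real.exp (-(t * x) ^ 2) * (2 * t * x ^ 2 * A ^ 2 / B ^ 2) := fun A B => by ring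
    rw [e]
    positivity
  have := hm (Set.left_mem_Icc.mpr zero_le_one) (Set.right_mem_Icc.mpr zero_le_one) zero_le_one
  simpa using this

lemma hermiteFun_ofReal (n : ℕ) (x : ℝ) : hermiteFun n x =
    ((Real.exp (-x ^ 2 / 2) * (hermitePoly ℝ n).eval x : ℝ) : ℂ) := by
  rw [hermiteFun, eval_ofReal_hermitePoly]
  push_cast
  rfl

lemma hermiteFunDeriv_ofReal (n : ℕ) (x : ℝ) : hermiteFunDeriv n x =
    ((Real.exp (-x ^ 2 / 2) *
      ((derivative (hermitePoly ℝ n)).eval x - x * (hermitePoly ℝ n).eval x) : ℝ) : ℂ) := by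
  have h : (derivative (hermitePoly ℂ n)).eval (x : ℂ) =
      ((derivative (hermitePoly ℝ n)).eval x : ℝ) := by
    rcases n with _ | n
    · simp
    · rw [eval_derivative_hermitePoly_succ, eval_derivative_hermitePoly_succ,
        eval_ofReal_hermitePoly]
      push_cast
      rfl
  rw [hermiteFunDeriv, eval_ofReal_hermitePoly, h]
  push_cast
  rfl

lemma norm_hermiteFun_conj (n : ℕ) (z : ℂ) :
    ‖hermiteFun n (starRingEnd ℂ z)‖ = ‖hermiteFun n z‖ := by
  have : hermiteFun n (starRingEnd ℂ z) = starRingEnd ℂ (hermiteFun n z) := by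
    rw [hermiteFun, hermiteFun, eval_conj_hermitePoly, map_mul, ← Complex.exp_conj]
    simp [Complex.conj_ofNat]
  rw [this, RCLike.norm_conj]

/-- The lower bound for the Hermite function off the real axis, inside the oscillatory range. -/
lemma soninFun_mul_sinh_sq_le (n : ℕ) {x Y : ℝ} (hx : x ^ 2 < 2 * n + 1) (hY : 0 ≤ Y) :
    MonotoneOn (fun y : ℝ => ‖hermiteFun n (x + y * Complex.I)‖ ^ 2) (Set.Icc 0 Y) ∧
    soninFun n 0 * (1 - |x| * Y ^ 2 / √(2 * n + 1 - x ^ 2)) *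
      Real.sinh (√(2 * n + 1 - x ^ 2) * Y) ^ 2 ≤ ‖hermiteFun n (x + Y * Complex.I)‖ ^ 2 := by
  set q : ℝ := 2 * n + 1 - x ^ 2 with hqdef
  have hq : 0 < q := by linarith
  set U : ℝ → ℂ := fun y => hermiteFun n (x + y * Complex.I) with hU
  set W : ℝ → ℂ := fun y => Complex.I * hermiteFunDeriv n (x + y * Complex.I) with hW
  have hline : ∀ y : ℝ, HasDerivAt (fun y : ℝ => (x : ℂ) + y * Complex.I) Complex.I y := fun y => by
    simpa using ((Complex.ofRealCLM.hasDerivAt (x := y)).mul_const Complex.I).const_add (x : ℂ)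
  have hUd : ∀ y, HasDerivAt U (W y) y := fun y =>
    ((hasDerivAt_hermiteFun n _).comp y (hline y)).congr_deriv (mul_comm _ _)
  have hWd : ∀ y : ℝ, HasDerivAt W (((q + y ^ 2 : ℝ) - (2 * x * y : ℝ) * Complex.I) * U y) y :=
    fun y => by
    refine (((hasDerivAt_hermiteFunDeriv n _).comp y (hline y)).const_mul Complex.I).congr_deriv ?_
    simp only [hU, hqdef]
    push_cast
    linear_combination ((x + y * Complex.I) ^ 2 - (2 * n + 1) - (y : ℂ) ^ 2) *
      hermiteFun n (x + y * Complex.I) * Complex.I_sq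
  have hU1 : ∀ y, HasDerivAt (fun y => (U y).re) (W y).re y := fun y =>
    Complex.reCLM.hasFDerivAt.comp_hasDerivAt y (hUd y)
  have hU2 : ∀ y, HasDerivAt (fun y => (U y).im) (W y).im y := fun y =>
    Complex.imCLM.hasFDerivAt.comp_hasDerivAt y (hUd y)
  have hW1 : ∀ y, HasDerivAt (fun y => (W y).re)
      ((q + y ^ 2) * (U y).re + 2 * x * y * (U y).im) y := fun y =>
    (Complex.reCLM.hasFDerivAt.comp_hasDerivAt y (hWd y)).congr_deriv (by
      rw [Complex.reCLM_apply, Complex.mul_re, Complex.sub_re, Complex.sub_im,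
        Complex.re_ofReal_mul, Complex.im_ofReal_mul, Complex.ofReal_re, Complex.ofReal_im,
        Complex.I_re, Complex.I_im]
      ring)
  have hW2 : ∀ y, HasDerivAt (fun y => (W y).im)
      ((q + y ^ 2) * (U y).im - 2 * x * y * (U y).re) y := fun y =>
    (Complex.imCLM.hasFDerivAt.comp_hasDerivAt y (hWd y)).congr_deriv (by
      rw [Complex.imCLM_apply, Complex.mul_im, Complex.sub_re, Complex.sub_im,
        Complex.re_ofReal_mul, Complex.im_ofReal_mul, Complex.ofReal_re, Complex.ofReal_im,
        Complex.I_re, Complex.I_im]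
      ring)
  have hU0 : U 0 = ((Real.exp (-x ^ 2 / 2) * (hermitePoly ℝ n).eval x : ℝ) : ℂ) := by
    simp only [hU]
    rw [← hermiteFun_ofReal]
    simp
  have hW0 : W 0 = Complex.I * ((Real.exp (-x ^ 2 / 2) *
      ((derivative (hermitePoly ℝ n)).eval x - x * (hermitePoly ℝ n).eval x) : ℝ) : ℂ) := by
    simp only [hW]
    rw [← hermiteFunDeriv_ofReal]
    simp
  set A := (hermitePoly ℝ n).eval x with hA
  set B := (derivative (hermitePoly ℝ n)).eval x - x * A with hB
  have hE : Real.exp (-x ^ 2 / 2) ^ 2 = Real.exp (-x ^ 2) := by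
    rw [← Real.exp_nat_mul]; congr 1; push_cast; ring
  set E := Real.exp (-x ^ 2 / 2) with hEdef
  clear_value E
  obtain ⟨r1, r2⟩ := sinh_sq_le_of_vertical_ode (q := q) (x := x) (Y := Y)
    (w := fun y => (U y).re ^ 2 + (U y).im ^ 2)
    (a := fun y => (U y).re * (W y).re + (U y).im * (W y).im)
    (v := fun y => (W y).re ^ 2 + (W y).im ^ 2)
    (J := fun y => (U y).im * (W y).re - (U y).re * (W y).im) hq hY
    (fun y => (((hU1 y).pow 2).add ((hU2 y).pow 2)).congr_deriv (by simp; ring))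
    (fun y => (((hU1 y).mul (hW1 y)).add ((hU2 y).mul (hW2 y))).congr_deriv (by ring))
    (fun y => (((hW1 y).pow 2).add ((hW2 y).pow 2)).congr_deriv (by simp; ring))
    (fun y => (((hU2 y).mul (hW1 y)).sub ((hU1 y).mul (hW2 y))).congr_deriv (by ring))
    (fun y => by positivity) (fun y => by positivity)
    (by simp [hU0, hW0]) (by
      apply le_of_eq
      simp [hU0, hW0]
      ring)
  have hnorm : ∀ y, ‖U y‖ ^ 2 = (U y).re ^ 2 + (U y).im ^ 2 := fun y => by
    rw [← Complex.normSq_eq_norm_sq, Complex.normSq_apply]; ring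
  have hS : (U 0).re ^ 2 + (U 0).im ^ 2 + ((W 0).re ^ 2 + (W 0).im ^ 2) / q = soninFun n x := by
    rw [soninFun, hU0, hW0, ← hE]
    simp [← hA, ← hB, ← hqdef]
    ring
  change MonotoneOn (fun y => ‖U y‖ ^ 2) _ ∧ _ ≤ ‖U Y‖ ^ 2
  simp only [hnorm]
  refine ⟨r1, ?_⟩
  have hw := add_nonneg (sq_nonneg (U Y).re) (sq_nonneg (U Y).im)
  have hS0 := soninFun_zero_nonneg n
  rw [hS] at r2
  rcases le_or_gt 0 (1 - |x| * Y ^ 2 / √q) with h | h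
  · refine le_trans ?_ r2
    have := soninFun_zero_le n hx
    gcongr
  · refine le_trans ?_ hw
    have h1 : soninFun n 0 * (1 - |x| * Y ^ 2 / √q) ≤ 0 :=
      mul_nonpos_of_nonneg_of_nonpos hS0 h.le
    exact mul_nonpos_of_nonpos_of_nonneg h1 (sq_nonneg _)

/-! ### Asymptotics of the normalizing constants -/

lemma eval_zero_hermitePoly_odd {R : Type*} [CommRing R] (m : ℕ) :
    (hermitePoly R (2 * m + 1)).eval 0 = 0 := by
  induction m with
  | zero => simp
  | succ m ih =>
    rw [show 2 * (m + 1) + 1 = 2 * m + 1 + 2 by ring, eval_hermitePoly_add_two, ih]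
    ring

lemma eval_zero_hermitePoly_even (m : ℕ) :
    (hermitePoly ℝ (2 * m)).eval 0 * m.factorial = (-1) ^ m * (2 * m).factorial := by
  induction m with
  | zero => simp
  | succ m ih =>
    rw [show 2 * (m + 1) = 2 * m + 2 by ring, eval_hermitePoly_add_two, Nat.factorial_succ m,
      Nat.factorial_succ (2 * m + 1), Nat.factorial_succ (2 * m)]
    push_cast
    linear_combination (-(2 * (2 * (m : ℝ) + 1) * (m + 1))) * ih

/-- The ratio `4ᵐ (m!)² / (2 m)!`, the reciprocal of the normalized central binomial
coefficient. -/
noncomputable def wallisRatio (m : ℕ) : ℝ :=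
  4 ^ m * (m.factorial : ℝ) ^ 2 / (2 * m).factorial

lemma tendsto_wallisRatio_div_sqrt :
    Tendsto (fun m : ℕ => wallisRatio m / √m) atTop (𝓝 √Real.pi) := by
  have h1 := Stirling.tendsto_stirlingSeq_sqrt_pi
  have h2 : Tendsto (fun m : ℕ => Stirling.stirlingSeq (2 * m)) atTop (𝓝 √Real.pi) :=
    h1.comp (tendsto_id.const_mul_atTop' two_pos)
  have hpi : √Real.pi ≠ 0 := (Real.sqrt_pos.mpr Real.pi_pos).ne'
  have h3 := (h1.pow 2).div h2 hpi
  have e : √Real.pi ^ 2 / √Real.pi = √Real.pi := by field_simp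
  rw [e] at h3
  refine h3.congr' ?_
  filter_upwards [eventually_gt_atTop 0] with m hm
  have hm' : (0 : ℝ) < m := by exact_mod_cast hm
  simp only [Pi.div_apply, Stirling.stirlingSeq, wallisRatio]
  have hs : (√(m : ℝ)) ^ 2 = m := Real.sq_sqrt hm'.le
  have hs2 : (√(2 : ℝ)) ^ 2 = 2 := Real.sq_sqrt two_pos.le
  have e1 : √(2 * (m : ℝ)) = √2 * √m := Real.sqrt_mul two_pos.le _
  have e2 : √(2 * ((2 * m : ℕ) : ℝ)) = 2 * √m := by
    push_cast
    rw [← mul_assoc, Real.sqrt_mul (by norm_num)]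
    norm_num
  rw [e1, e2]
  push_cast
  have e3 : (2 * (m : ℝ) / Real.exp 1) ^ (2 * m) = 4 ^ m * ((m / Real.exp 1) ^ m) ^ 2 := by
    rw [mul_div_assoc, mul_pow, pow_mul 2 2 m, ← pow_mul _ m 2, mul_comm m 2]; norm_num
  rw [e3]
  have hsp : 0 < √(m : ℝ) := Real.sqrt_pos.mpr hm'
  have hx : 0 < ((m : ℝ) / Real.exp 1) ^ m := by positivity
  rw [div_pow, mul_pow, mul_pow, hs2]
  field_simp

/-- `‖Hₙ‖²` in `L²_ω`, divided by the squared amplitude of the Hermite function at the origin. -/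
noncomputable def amplitudeRatio (n : ℕ) : ℝ :=
  √Real.pi * 2 ^ n * n.factorial / soninFun n 0

lemma eval_zero_derivative_hermitePoly_even (m : ℕ) :
    (derivative (hermitePoly ℝ (2 * m))).eval 0 = 0 := by
  rcases m with _ | m
  · simp
  · rw [show 2 * (m + 1) = 2 * m + 1 + 1 by ring, eval_derivative_hermitePoly_succ,
      eval_zero_hermitePoly_odd, mul_zero]

lemma soninFun_zero_even (m : ℕ) :
    soninFun (2 * m) 0 = ((2 * m).factorial / m.factorial : ℝ) ^ 2 := by
  have h := eval_zero_hermitePoly_even m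
  have hm : (m.factorial : ℝ) ≠ 0 := by positivity
  have h2 : (hermitePoly ℝ (2 * m)).eval 0 = (-1) ^ m * ((2 * m).factorial / m.factorial) := by
    field_simp
    exact h
  rw [soninFun_zero, eval_zero_derivative_hermitePoly_even, h2, mul_pow, ← pow_mul, mul_comm m 2, pow_mul]
  simp

lemma soninFun_zero_odd (m : ℕ) :
    soninFun (2 * m + 1) 0 =
      (2 * (2 * m + 1)) ^ 2 / (2 * (2 * m + 1) + 1) *
        ((2 * m).factorial / m.factorial : ℝ) ^ 2 := by
  have h := soninFun_zero_even m
  rw [soninFun_zero] at h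
  rw [eval_zero_derivative_hermitePoly_even] at h
  rw [soninFun_zero, eval_zero_hermitePoly_odd, eval_derivative_hermitePoly_succ, ← h]
  push_cast
  field_simp
  ring

lemma soninFun_zero_pos (n : ℕ) : 0 < soninFun n 0 := by
  rcases Nat.even_or_odd' n with ⟨m, rfl | rfl⟩
  · rw [soninFun_zero_even]; positivity
  · rw [soninFun_zero_odd]; positivity

lemma amplitudeRatio_bounds {n : ℕ} (hn : 0 < n) :
    √Real.pi * wallisRatio (n / 2) ≤ amplitudeRatio n ∧
    amplitudeRatio n ≤ √Real.pi * wallisRatio (n / 2) * (1 + 1 / (2 * n)) := by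
  have hw : ∀ m, 0 ≤ √Real.pi * wallisRatio m := fun m => by unfold wallisRatio; positivity
  rcases Nat.even_or_odd' n with ⟨m, rfl | rfl⟩
  · have e : amplitudeRatio (2 * m) = √Real.pi * wallisRatio (2 * m / 2) := by
      rw [Nat.mul_div_cancel_left m two_pos, amplitudeRatio, soninFun_zero_even, wallisRatio,
        pow_mul]
      norm_num
      field_simp
    rw [e]
    exact ⟨le_rfl, le_mul_of_one_le_right (hw _) (by simp)⟩
  · have e : amplitudeRatio (2 * m + 1) = √Real.pi * wallisRatio ((2 * m + 1) / 2) *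
        (1 + 1 / (2 * ((2 * m + 1 : ℕ) : ℝ))) := by
      rw [show (2 * m + 1) / 2 = m by omega, amplitudeRatio, soninFun_zero_odd, wallisRatio,
        pow_succ, pow_mul, Nat.factorial_succ]
      push_cast
      norm_num
      field_simp
    rw [e]
    exact ⟨le_mul_of_one_le_right (hw _) (by simp; positivity), le_rfl⟩

lemma tendsto_amplitudeRatio :
    Tendsto (fun n : ℕ => amplitudeRatio (n + 1) / √n) atTop (𝓝 (Real.pi / √2)) := by
  have hM : Tendsto (fun n : ℕ => (n + 1) / 2) atTop atTop :=
    (Nat.tendsto_div_const_atTop two_ne_zero).comp (tendsto_add_atTop_nat 1)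
  have h1 := tendsto_wallisRatio_div_sqrt.comp hM
  have hinv : Tendsto (fun n : ℕ => 1 / (n : ℝ)) atTop (𝓝 0) := tendsto_one_div_atTop_nhds_zero_nat
  have h2 : Tendsto (fun n : ℕ => (((n + 1) / 2 : ℕ) : ℝ) / n) atTop (𝓝 (1 / 2)) := by
    refine tendsto_of_tendsto_of_tendsto_of_le_of_le'
      (g := fun _ => (1 / 2 : ℝ)) (h := fun n : ℕ => 1 / 2 + 1 / 2 * (1 / (n : ℝ)))
      tendsto_const_nhds (by
        have := (hinv.const_mul (1 / 2)).const_add (1 / 2)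
        rwa [mul_zero, add_zero] at this) ?_ ?_
    · filter_upwards [eventually_gt_atTop 0] with n hn
      have hn' : (0 : ℝ) < n := by exact_mod_cast hn
      rw [le_div_iff₀ hn']
      have : n ≤ 2 * ((n + 1) / 2) := by omega
      have : (n : ℝ) ≤ 2 * (((n + 1) / 2 : ℕ) : ℝ) := by exact_mod_cast this
      linarith
    · filter_upwards [eventually_gt_atTop 0] with n hn
      have hn' : (0 : ℝ) < n := by exact_mod_cast hn
      rw [div_le_iff₀ hn']
      have : 2 * ((n + 1) / 2) ≤ n + 1 := by omega
      have : 2 * (((n + 1) / 2 : ℕ) : ℝ) ≤ n + 1 := by exact_mod_cast this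
      have e : (1 / 2 + 1 / 2 * (1 / (n : ℝ))) * n = (n + 1) / 2 := by field_simp
      linarith
  have h3 := (Real.continuous_sqrt.tendsto (1 / 2)).comp h2
  have h4 := ((h1.mul h3).const_mul √Real.pi)
  have e4 : √Real.pi * (√Real.pi * √(1 / 2)) = Real.pi / √2 := by
    rw [← mul_assoc, Real.mul_self_sqrt Real.pi_pos.le, Real.sqrt_div zero_le_one]; simp; ring
  rw [e4] at h4
  have h5 : Tendsto (fun n : ℕ => √Real.pi * wallisRatio ((n + 1) / 2) / √n) atTop
      (𝓝 (Real.pi / √2)) := by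
    refine h4.congr' ?_
    filter_upwards [eventually_gt_atTop 0] with n hn
    have hn' : (0 : ℝ) < n := by exact_mod_cast hn
    have hm : (0 : ℝ) < (((n + 1) / 2 : ℕ) : ℝ) := by
      have : 0 < (n + 1) / 2 := by omega
      exact_mod_cast this
    have := Real.sqrt_pos.mpr hm
    simp only [Function.comp]
    rw [Real.sqrt_div hm.le]
    field_simp
  have h6 : Tendsto (fun n : ℕ => 1 + 1 / (2 * ((n + 1 : ℕ) : ℝ))) atTop (𝓝 1) := by
    have := ((hinv.comp (tendsto_add_atTop_nat 1)).const_mul (1 / 2)).const_add 1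
    simp only [mul_zero, add_zero] at this
    refine this.congr fun n => ?_
    simp only [Function.comp]
    field_simp
  have h7 := h5.mul h6
  rw [mul_one] at h7
  refine tendsto_of_tendsto_of_tendsto_of_le_of_le h5 h7 (fun n => ?_) (fun n => ?_)
  · exact div_le_div_of_nonneg_right (amplitudeRatio_bounds n.succ_pos).1 (Real.sqrt_nonneg _)
  · have := div_le_div_of_nonneg_right (amplitudeRatio_bounds n.succ_pos).2 (Real.sqrt_nonneg n)
    refine this.trans (le_of_eq ?_)
    ring

lemma tendsto_sqrt_amplitudeRatio :
    Tendsto (fun n : ℕ => √(amplitudeRatio (n + 1)) / (n : ℝ) ^ (1 / 4 : ℝ)) atTop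
      (𝓝 (√Real.pi / 2 ^ (1 / 4 : ℝ))) := by
  have h := (Real.continuous_sqrt.tendsto _).comp tendsto_amplitudeRatio
  have hs : ∀ t : ℝ, 0 ≤ t → √√t = t ^ (1 / 4 : ℝ) := fun t ht => by
    rw [Real.sqrt_eq_rpow, Real.sqrt_eq_rpow, ← Real.rpow_mul ht]; norm_num
  rw [Real.sqrt_div Real.pi_pos.le, hs 2 two_pos.le] at h
  refine h.congr fun n => ?_
  simp only [Function.comp]
  rw [Real.sqrt_div' _ (Real.sqrt_nonneg _), hs n n.cast_nonneg]

/-- A crude consequence of Stirling's formula. -/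
lemma eventually_soninFun_zero_le :
    ∀ᶠ n : ℕ in atTop, soninFun (n + 1) 0 ≤ √Real.pi * 2 ^ (n + 1) * (n + 1).factorial := by
  have h0 : (1 : ℝ) < Real.pi / √2 := by
    rw [one_lt_div (by positivity)]
    have := Real.sqrt_lt_sqrt (by norm_num) (show (2 : ℝ) < 3 ^ 2 by norm_num)
    rw [Real.sqrt_sq (by norm_num)] at this
    exact this.trans Real.pi_gt_three
  filter_upwards [tendsto_amplitudeRatio.eventually_const_lt h0, eventually_gt_atTop 0] with n h hn
  have hn' : (1 : ℝ) ≤ n := by exact_mod_cast hn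
  have h1 : 1 ≤ √(n : ℝ) := Real.one_le_sqrt.mpr hn'
  rw [lt_div_iff₀ (by linarith), amplitudeRatio, lt_div_iff₀ (soninFun_zero_pos _)] at h
  nlinarith [soninFun_zero_pos (n + 1)]

lemma factorial_le_stirling {n : ℕ} (hn : 0 < n) :
    (n.factorial : ℝ) ≤ Real.exp 1 * √n * (n / Real.exp 1) ^ n := by
  obtain ⟨m, rfl⟩ := Nat.exists_eq_succ_of_ne_zero hn.ne'
  have h := Stirling.stirlingSeq'_antitone (Nat.zero_le m)
  simp only [Function.comp, Stirling.stirlingSeq_one, Nat.succ_eq_add_one, zero_add] at h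
  rw [Stirling.stirlingSeq, div_le_iff₀ (by positivity)] at h
  refine h.trans (le_of_eq ?_)
  rw [Real.sqrt_mul two_pos.le]
  field_simp

/-! ### Uniform and pointwise lower bounds on the lines `Im z = ±ρ` -/

lemma exists_one_add_sq_pow_le (k : ℕ) :
    ∃ A : ℝ, 0 < A ∧ ∀ x : ℝ, (1 + x ^ 2) ^ k ≤ A * Real.exp (x ^ 2 / 4) := by
  refine ⟨4 ^ k * k.factorial * Real.exp (1 / 4), by positivity, fun x => ?_⟩
  have h := Real.pow_div_factorial_le_exp (x := (1 + x ^ 2) / 4) (by positivity) k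
  rw [div_le_iff₀ (by positivity), div_pow, div_le_iff₀ (by positivity),
    show (1 + x ^ 2) / 4 = 1 / 4 + x ^ 2 / 4 by ring, Real.exp_add] at h
  linarith

lemma tendsto_pow_mul_exp_sqrt_mul_exp_neg (B : ℝ) {c : ℝ} (hc : 0 < c) (j : ℕ) :
    Tendsto (fun n : ℕ => ((n : ℝ) + 1) ^ j * Real.exp (B * √(2 * n)) *
      Real.exp (-(c * (n + 1)))) atTop (𝓝 0) := by
  have hlin : Tendsto (fun n : ℕ => c / 2 * ((n : ℝ) + 1)) atTop atTop :=
    (tendsto_atTop_add_const_right _ 1 tendsto_natCast_atTop_atTop).const_mul_atTop (by positivity)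
  have h1 := ((Real.tendsto_pow_mul_exp_neg_atTop_nhds_zero j).comp hlin).const_mul
    ((2 / c) ^ j * Real.exp (B ^ 2 / c))
  rw [mul_zero] at h1
  refine squeeze_zero (fun n => by positivity) (fun n => ?_) h1
  have h2 : B * √(2 * n) ≤ c / 2 * (n + 1) + B ^ 2 / c := by
    have hs : √(2 * (n : ℝ)) ^ 2 = 2 * n := Real.sq_sqrt (by positivity)
    have h3 : 0 ≤ c / 4 * (√(2 * (n : ℝ)) - 2 * B / c) ^ 2 := by positivity
    have h4 : c / 4 * (√(2 * (n : ℝ)) - 2 * B / c) ^ 2 =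
        c / 4 * √(2 * (n : ℝ)) ^ 2 - B * √(2 * n) + B ^ 2 / c := by field_simp; ring
    rw [h4, hs] at h3
    nlinarith
  simp only [Function.comp]
  calc ((n : ℝ) + 1) ^ j * Real.exp (B * √(2 * n)) * Real.exp (-(c * (n + 1)))
      ≤ ((n : ℝ) + 1) ^ j * Real.exp (c / 2 * (n + 1) + B ^ 2 / c) *
          Real.exp (-(c * (n + 1))) := by gcongr
    _ = ((n : ℝ) + 1) ^ j * (Real.exp (B ^ 2 / c) * Real.exp (-(c / 2 * (n + 1)))) := by
      rw [mul_assoc, ← Real.exp_add, ← Real.exp_add]; congr 2; ring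
    _ = (2 / c) ^ j * Real.exp (B ^ 2 / c) *
          ((c / 2 * (n + 1)) ^ j * Real.exp (-(c / 2 * (n + 1)))) := by
      rw [mul_pow, div_pow, div_pow]; field_simp

/-- The size of `Hₙ₊₁(z) exp(-z²/2)` for `Im z = ±ρ`, up to a factor tending to `1`. -/
noncomputable def hermiteScale (ρ : ℝ) (n : ℕ) : ℝ :=
  √(soninFun (n + 1) 0) * Real.exp (ρ * √(2 * n)) / 2

lemma hermiteScale_pos (ρ : ℝ) (n : ℕ) : 0 < hermiteScale ρ n := by
  have := Real.sqrt_pos.mpr (soninFun_zero_pos (n + 1))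
  unfold hermiteScale
  positivity

lemma hermiteScale_sq (ρ : ℝ) (n : ℕ) :
    hermiteScale ρ n ^ 2 = soninFun (n + 1) 0 * Real.exp (2 * ρ * √(2 * n)) / 4 := by
  rw [hermiteScale, div_pow, mul_pow, Real.sq_sqrt (soninFun_zero_nonneg _), ← Real.exp_nat_mul]
  push_cast
  norm_num [mul_assoc]

lemma norm_cexp_neg_sq_div_two (x y : ℝ) :
    ‖Complex.exp (-((x : ℂ) + y * Complex.I) ^ 2 / 2)‖ = Real.exp (-(x ^ 2 - y ^ 2) / 2) := by
  rw [Complex.norm_exp]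
  congr 1
  have : (-((x : ℂ) + y * Complex.I) ^ 2 / 2) =
      ((-(x ^ 2 - y ^ 2) / 2 : ℝ) : ℂ) - ((x * y : ℝ) : ℂ) * Complex.I := by
    push_cast
    linear_combination (-(y : ℂ) ^ 2 / 2) * Complex.I_sq
  rw [this, Complex.sub_re, Complex.ofReal_re, Complex.re_ofReal_mul, Complex.I_re]
  ring

/-- For `|x| ≤ √(n + 1) / (1 + 2 ρ²)` the factor `sinh² (√q ρ)` is large enough, since
`√q` differs from `√(2 n)` by at most a small multiple of `x²`. -/
lemma hermiteScale_sq_le_center {ρ : ℝ} (hρ : 0 < ρ) {n : ℕ} {x : ℝ}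
    (hn1 : 4 * ρ ≤ √((n : ℝ) + 1)) (hn2 : 1 ≤ √((n : ℝ) + 1) * ρ)
    (hx : |x| * (1 + 2 * ρ ^ 2) ≤ √((n : ℝ) + 1)) :
    hermiteScale ρ n ^ 2 * Real.exp (-x ^ 2 / 4) ≤
      8 * ‖hermiteFun (n + 1) (x + ρ * Complex.I)‖ ^ 2 := by
  have hN : √((n : ℝ) + 1) ^ 2 = n + 1 := Real.sq_sqrt (by positivity)
  have hxN : |x| ≤ √((n : ℝ) + 1) := by nlinarith [abs_nonneg x, sq_nonneg ρ]
  have hx2 : x ^ 2 ≤ n + 1 := by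
    rw [← hN, ← sq_abs]; gcongr
  have hx3 : x ^ 2 < 2 * ((n + 1 : ℕ) : ℝ) + 1 := by push_cast; linarith
  have hmain := (soninFun_mul_sinh_sq_le (n + 1) hx3 hρ.le).2
  set q : ℝ := 2 * ((n + 1 : ℕ) : ℝ) + 1 - x ^ 2 with hq
  have hqN : (n : ℝ) + 1 ≤ q := by rw [hq]; push_cast; linarith
  have hsq : √((n : ℝ) + 1) ≤ √q := Real.sqrt_le_sqrt hqN
  have hqpos : 0 < √q := Real.sqrt_pos.mpr (by linarith [n.cast_nonneg (α := ℝ)])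
  have hfac : 1 / 2 ≤ 1 - |x| * ρ ^ 2 / √q := by
    have : |x| * ρ ^ 2 / √q ≤ 1 / 2 := by
      rw [div_le_iff₀ hqpos]
      nlinarith [abs_nonneg x]
    linarith
  have hsinh : Real.exp (√q * ρ) / 4 ≤ Real.sinh (√q * ρ) := by
    have h1 : 1 ≤ √q * ρ := hn2.trans (by gcongr)
    have h2 : 2 ≤ Real.exp (√q * ρ) := by
      have := Real.add_one_le_exp (√q * ρ); linarith
    have h3 : Real.exp (-(√q * ρ)) ≤ 1 := Real.exp_le_one_iff.mpr (by linarith)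
    rw [Real.sinh_eq]
    linarith
  have hsqrt : √(2 * (n : ℝ)) ≤ √q + x ^ 2 / (8 * ρ) := by
    refine Real.sqrt_le_iff.mpr ⟨by positivity, ?_⟩
    have h1 : √q ^ 2 = q := Real.sq_sqrt (by linarith [n.cast_nonneg (α := ℝ)])
    have h2 : x ^ 2 ≤ 2 * √q * (x ^ 2 / (8 * ρ)) := by
      have : 2 * √q * (x ^ 2 / (8 * ρ)) = x ^ 2 * (√q / (4 * ρ)) := by field_simp; ring
      rw [this]
      refine le_mul_of_one_le_right (sq_nonneg x) ?_
      rw [one_le_div (by positivity)]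
      linarith
    have h3 : 0 ≤ (x ^ 2 / (8 * ρ)) ^ 2 := sq_nonneg _
    have h4 : q = 2 * n + 3 - x ^ 2 := by rw [hq]; push_cast; ring
    nlinarith
  have hS := soninFun_zero_pos (n + 1)
  have hexp : Real.exp (2 * ρ * √(2 * n)) * Real.exp (-x ^ 2 / 4) ≤
      Real.exp (√q * ρ) ^ 2 := by
    rw [← Real.exp_add, ← Real.exp_nat_mul]
    refine Real.exp_le_exp.mpr ?_
    have := mul_le_mul_of_nonneg_left hsqrt (by positivity : 0 ≤ 2 * ρ)
    have e : 2 * ρ * (√q + x ^ 2 / (8 * ρ)) = 2 * ρ * √q + x ^ 2 / 4 := by field_simp; ring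
    push_cast
    linarith
  have hsinh2 : Real.exp (√q * ρ) ^ 2 ≤ 16 * Real.sinh (√q * ρ) ^ 2 := by
    have := pow_le_pow_left₀ (by positivity) hsinh 2
    rw [div_pow] at this
    linarith
  rw [hermiteScale_sq]
  calc soninFun (n + 1) 0 * Real.exp (2 * ρ * √(2 * n)) / 4 * Real.exp (-x ^ 2 / 4)
      = soninFun (n + 1) 0 / 4 * (Real.exp (2 * ρ * √(2 * n)) * Real.exp (-x ^ 2 / 4)) := by ring
    _ ≤ soninFun (n + 1) 0 / 4 * (16 * Real.sinh (√q * ρ) ^ 2) := by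
        exact mul_le_mul_of_nonneg_left (hexp.trans hsinh2) (by positivity)
    _ = 8 * (soninFun (n + 1) 0 * (1 / 2) * Real.sinh (√q * ρ) ^ 2) := by ring
    _ ≤ 8 * (soninFun (n + 1) 0 * (1 - |x| * ρ ^ 2 / √q) * Real.sinh (√q * ρ) ^ 2) := by
        gcongr
    _ ≤ _ := by gcongr

/-- For all `|x| ≤ √(2 (n + 1))` there is a bound that loses only a power of `n`; it is obtained
at height `1 / (2 (n + 1))` and carried to height `ρ` by monotonicity. -/
lemma soninFun_le_of_sq_le {ρ : ℝ} {n : ℕ} {x : ℝ}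
    (hn : 1 / (2 * ((n : ℝ) + 1)) ≤ ρ) (hx : x ^ 2 ≤ 2 * (n + 1)) :
    soninFun (n + 1) 0 ≤
      8 * ((n : ℝ) + 1) ^ 2 * ‖hermiteFun (n + 1) (x + ρ * Complex.I)‖ ^ 2 := by
  set y : ℝ := 1 / (2 * ((n : ℝ) + 1)) with hy
  have hn0 : (0 : ℝ) ≤ n := n.cast_nonneg
  have hy0 : 0 < y := by positivity
  have hx3 : x ^ 2 < 2 * ((n + 1 : ℕ) : ℝ) + 1 := by push_cast; linarith
  have hmono := (soninFun_mul_sinh_sq_le (n + 1) hx3 (hy0.le.trans hn)).1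
    (Set.mem_Icc.mpr ⟨hy0.le, hn⟩) (Set.right_mem_Icc.mpr (hy0.le.trans hn)) hn
  have hmain := (soninFun_mul_sinh_sq_le (n + 1) hx3 hy0.le).2
  set q : ℝ := 2 * ((n + 1 : ℕ) : ℝ) + 1 - x ^ 2 with hq
  have hq1 : 1 ≤ √q := Real.one_le_sqrt.mpr (by rw [hq]; push_cast; linarith)
  have hfac : 1 / 2 ≤ 1 - |x| * y ^ 2 / √q := by
    have h1 : |x| ≤ 2 * (n + 1) := abs_le_of_sq_le_sq (by nlinarith) (by positivity)
    have h2 : |x| * y ^ 2 ≤ 1 / 2 := by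
      calc |x| * y ^ 2 ≤ 2 * (n + 1) * y ^ 2 := by gcongr
        _ = y := by rw [hy]; field_simp
        _ ≤ 1 / 2 := by
          rw [hy]
          apply one_div_le_one_div_of_le two_pos
          linarith
    have : |x| * y ^ 2 / √q ≤ 1 / 2 := by
      rw [div_le_iff₀ (by linarith)]
      linarith
    linarith
  have hsinh : y ≤ Real.sinh (√q * y) := by
    have h1 : y ≤ √q * y := le_mul_of_one_le_left hy0.le hq1
    exact h1.trans (Real.self_le_sinh_iff.mpr (by positivity))
  have hS := soninFun_zero_pos (n + 1)
  have h1 : soninFun (n + 1) 0 * (1 / 2) * y ^ 2 ≤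
      ‖hermiteFun (n + 1) (x + ρ * Complex.I)‖ ^ 2 := by
    refine le_trans ?_ (hmain.trans hmono)
    gcongr
  have h2 : soninFun (n + 1) 0 * (1 / 2) * y ^ 2 =
      soninFun (n + 1) 0 / (8 * ((n : ℝ) + 1) ^ 2) := by rw [hy]; field_simp; ring
  rw [h2, div_le_iff₀ (by positivity)] at h1
  linarith

/-- Outside the oscillatory range the Hermite polynomial is at least as large as the monomial. -/
lemma pow_mul_exp_le_norm_hermiteFun_sq {ρ : ℝ} {n : ℕ} {x : ℝ} (hx : 2 * ((n : ℝ) + 1) ≤ x ^ 2) :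
    (x ^ 2) ^ (n + 1) * Real.exp (-x ^ 2) ≤
      ‖hermiteFun (n + 1) (x + ρ * Complex.I)‖ ^ 2 := by
  have hz : ‖(x : ℂ) + ρ * Complex.I‖ ^ 2 = x ^ 2 + ρ ^ 2 := by
    rw [← Complex.normSq_eq_norm_sq, Complex.normSq_add_mul_I]
  have h1 : ‖(x : ℂ) + ρ * Complex.I‖ ^ (n + 1) ≤
      ‖(hermitePoly ℂ (n + 1)).eval ((x : ℂ) + ρ * Complex.I)‖ := by
    refine norm_pow_le_norm_hermitePoly ?_
    rw [hz]
    push_cast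
    nlinarith [sq_nonneg ρ]
  have h2 := pow_le_pow_left₀ (by positivity) h1 2
  rw [← pow_mul, mul_comm (n + 1) 2, pow_mul, hz] at h2
  rw [hermiteFun, norm_mul, norm_cexp_neg_sq_div_two, mul_pow, ← Real.exp_nat_mul, mul_comm]
  have h3 : (x ^ 2) ^ (n + 1) ≤ (x ^ 2 + ρ ^ 2) ^ (n + 1) := by
    gcongr; nlinarith [sq_nonneg ρ]
  have h4 : -x ^ 2 ≤ ((2 : ℕ) : ℝ) * (-(x ^ 2 - ρ ^ 2) / 2) := by
    push_cast; nlinarith [sq_nonneg ρ]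
  gcongr
  exact h3.trans h2

/-- The uniform lower bound for the Hermite functions on the line `Im z = ρ`. -/
lemma exists_hermiteScale_mul_le {ρ : ℝ} (hρ : 0 < ρ) (k : ℕ) :
    ∃ C : ℝ, 0 < C ∧ ∀ᶠ n : ℕ in atTop, ∀ x : ℝ,
      hermiteScale ρ n * (1 + x ^ 2) ^ k * Real.exp (-x ^ 2 / 2) ≤
        C * ‖hermiteFun (n + 1) (x + ρ * Complex.I)‖ := by
  obtain ⟨A, hA, hAk⟩ := exists_one_add_sq_pow_le (2 * k)
  set ε : ℝ := 1 / (1 + 2 * ρ ^ 2) with hε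
  have hε0 : 0 < ε := by positivity
  have hsqrt : Tendsto (fun n : ℕ => √((n : ℝ) + 1)) atTop atTop :=
    Real.tendsto_sqrt_atTop.comp
      (tendsto_atTop_add_const_right _ 1 tendsto_natCast_atTop_atTop)
  have hinv : Tendsto (fun n : ℕ => 1 / (2 * ((n : ℝ) + 1))) atTop (𝓝 0) :=
    tendsto_const_nhds.div_atTop ((tendsto_atTop_add_const_right _ 1
      tendsto_natCast_atTop_atTop).const_mul_atTop two_pos)
  have hb := tendsto_pow_mul_exp_sqrt_mul_exp_neg (2 * ρ) (c := ε ^ 2 / 2) (by positivity) 2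
  have hcc := tendsto_pow_mul_exp_sqrt_mul_exp_neg (2 * ρ) (c := 1) one_pos (2 * k + 1)
  have hb' := (hb.const_mul (2 * A))
  have hc' := hcc.const_mul (√Real.pi * Real.exp 1 * 16 ^ k)
  rw [mul_zero] at hb' hc'
  refine ⟨√(8 * A + 2), by positivity, ?_⟩
  filter_upwards [hsqrt.eventually_ge_atTop (4 * ρ), hsqrt.eventually_ge_atTop (1 / ρ),
    hinv.eventually_le_const hρ, hb'.eventually_le_const one_pos,
    hc'.eventually_le_const one_pos, eventually_soninFun_zero_le, eventually_ge_atTop (2 * k)]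
    with n hn1 hn2 hn3 hn4 hn5 hn6 hn7 x
  refine le_of_sq_le_sq ?_ (by positivity)
  rw [mul_pow, mul_pow, mul_pow, ← pow_mul, mul_comm k 2, ← Real.exp_nat_mul,
    Real.sq_sqrt (by positivity),
    show ((2 : ℕ) : ℝ) * (-x ^ 2 / 2) = -x ^ 2 by push_cast; ring]
  set w := ‖hermiteFun (n + 1) (x + ρ * Complex.I)‖ ^ 2 with hw
  have hw0 : 0 ≤ w := sq_nonneg _
  have hS := soninFun_zero_pos (n + 1)
  have hN : √((n : ℝ) + 1) ^ 2 = n + 1 := Real.sq_sqrt (by positivity)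
  have hsc : 0 ≤ hermiteScale ρ n ^ 2 := sq_nonneg _
  have hAw : 0 ≤ A * w := by positivity
  -- The central range, the rest of the oscillatory range, where `exp(-x²)` is small enough to
  -- absorb `exp(2 ρ √(2 n))`, and the range where `Hₙ₊₁` dominates the monomial.
  rcases le_or_gt (|x| * (1 + 2 * ρ ^ 2)) (√((n : ℝ) + 1)) with hx | hx
  · have h := hermiteScale_sq_le_center hρ hn1 (by rwa [div_le_iff₀ hρ] at hn2) hx
    rw [← hw] at h
    calc hermiteScale ρ n ^ 2 * (1 + x ^ 2) ^ (2 * k) * Real.exp (-x ^ 2)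
        ≤ hermiteScale ρ n ^ 2 * (A * Real.exp (x ^ 2 / 4)) * Real.exp (-x ^ 2) := by
          gcongr; exact hAk x
      _ = A * (hermiteScale ρ n ^ 2 * Real.exp (-(3 * x ^ 2) / 4)) := by
          rw [show -(3 * x ^ 2) / 4 = x ^ 2 / 4 + -x ^ 2 by ring, Real.exp_add]; ring
      _ ≤ A * (hermiteScale ρ n ^ 2 * Real.exp (-x ^ 2 / 4)) := by
          gcongr; nlinarith [sq_nonneg x]
      _ ≤ A * (8 * w) := by gcongr
      _ ≤ (8 * A + 2) * w := by linarith
  rcases le_or_gt (x ^ 2) (2 * ((n : ℝ) + 1)) with hx2 | hx2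
  · have h := soninFun_le_of_sq_le hn3 hx2
    rw [← hw] at h
    have hx3 : ε ^ 2 * (n + 1) ≤ x ^ 2 := by
      rw [← hN, ← mul_pow, ← sq_abs x]
      have : ε * √((n : ℝ) + 1) ≤ |x| := by
        rw [hε, div_mul_eq_mul_div, one_mul, div_le_iff₀ (by positivity)]
        exact hx.le
      gcongr
    calc hermiteScale ρ n ^ 2 * (1 + x ^ 2) ^ (2 * k) * Real.exp (-x ^ 2)
        ≤ hermiteScale ρ n ^ 2 * (A * Real.exp (x ^ 2 / 4)) * Real.exp (-x ^ 2) := by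
          gcongr; exact hAk x
      _ = A * (hermiteScale ρ n ^ 2 * Real.exp (-(3 * x ^ 2) / 4)) := by
          rw [show -(3 * x ^ 2) / 4 = x ^ 2 / 4 + -x ^ 2 by ring, Real.exp_add]; ring
      _ ≤ A * (hermiteScale ρ n ^ 2 * Real.exp (-(ε ^ 2 / 2 * (n + 1)))) := by
          gcongr; nlinarith [sq_nonneg x]
      _ = A / 4 * soninFun (n + 1) 0 *
            (Real.exp (2 * ρ * √(2 * n)) * Real.exp (-(ε ^ 2 / 2 * (n + 1)))) := by
          rw [hermiteScale_sq]; ring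
      _ ≤ A / 4 * (8 * ((n : ℝ) + 1) ^ 2 * w) *
            (Real.exp (2 * ρ * √(2 * n)) * Real.exp (-(ε ^ 2 / 2 * (n + 1)))) := by gcongr
      _ = 2 * A * (((n : ℝ) + 1) ^ 2 * Real.exp (2 * ρ * √(2 * n)) *
            Real.exp (-(ε ^ 2 / 2 * (n + 1)))) * w := by ring
      _ ≤ 1 * w := by gcongr
      _ ≤ (8 * A + 2) * w := by linarith
  · have h := pow_mul_exp_le_norm_hermiteFun_sq (ρ := ρ) hx2.le
    rw [← hw] at h
    have hfact := factorial_le_stirling n.succ_pos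
    rw [Nat.succ_eq_add_one] at hfact
    have hS2 : soninFun (n + 1) 0 ≤ √Real.pi * Real.exp 1 * (n + 1) *
        ((2 * (n + 1)) ^ (n + 1) * Real.exp (-(n + 1))) := by
      have h1 : √(((n + 1 : ℕ)) : ℝ) ≤ n + 1 := by
        rw [Real.sqrt_le_iff]
        push_cast
        exact ⟨by positivity, by nlinarith [n.cast_nonneg (α := ℝ)]⟩
      have e1 : Real.exp 1 ^ (n + 1) = Real.exp (n + 1) := by
        rw [← Real.exp_nat_mul]; push_cast; simp
      calc soninFun (n + 1) 0 ≤ √Real.pi * 2 ^ (n + 1) * (n + 1).factorial := hn6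
        _ ≤ √Real.pi * 2 ^ (n + 1) * (Real.exp 1 * (n + 1) *
              (((n + 1 : ℕ) : ℝ) / Real.exp 1) ^ (n + 1)) := by
            gcongr
            refine hfact.trans ?_
            gcongr
        _ = _ := by
            rw [div_pow, e1, Real.exp_neg, mul_pow]
            push_cast
            field_simp
    have hx1 : 1 ≤ x ^ 2 := by linarith [n.cast_nonneg (α := ℝ)]
    have hpow : (1 + x ^ 2) ^ (2 * k) * (2 * ((n : ℝ) + 1)) ^ (n + 1) ≤
        16 ^ k * ((n : ℝ) + 1) ^ (2 * k) * (x ^ 2) ^ (n + 1) := by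
      obtain ⟨m, hm⟩ := Nat.exists_eq_add_of_le (show 2 * k ≤ n + 1 by omega)
      calc (1 + x ^ 2) ^ (2 * k) * (2 * ((n : ℝ) + 1)) ^ (n + 1)
          ≤ (2 * x ^ 2) ^ (2 * k) * ((2 * ((n : ℝ) + 1)) ^ (2 * k) *
              (2 * ((n : ℝ) + 1)) ^ m) := by
            rw [hm, pow_add]; gcongr; linarith
        _ ≤ (2 * x ^ 2) ^ (2 * k) * ((2 * ((n : ℝ) + 1)) ^ (2 * k) * (x ^ 2) ^ m) := by
            gcongr
        _ = _ := by
            have e : (16 : ℝ) ^ k = 2 ^ (2 * k) * 2 ^ (2 * k) := by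
              rw [← mul_pow, pow_mul]; norm_num
            rw [hm, pow_add, mul_pow, mul_pow 2 ((n : ℝ) + 1), e]
            ring
    calc hermiteScale ρ n ^ 2 * (1 + x ^ 2) ^ (2 * k) * Real.exp (-x ^ 2)
        = soninFun (n + 1) 0 * (Real.exp (2 * ρ * √(2 * n)) / 4 * (1 + x ^ 2) ^ (2 * k) *
            Real.exp (-x ^ 2)) := by rw [hermiteScale_sq]; ring
      _ ≤ (√Real.pi * Real.exp 1 * (n + 1) *
            ((2 * (n + 1)) ^ (n + 1) * Real.exp (-(n + 1)))) *
            (Real.exp (2 * ρ * √(2 * n)) / 4 * (1 + x ^ 2) ^ (2 * k) * Real.exp (-x ^ 2)) := by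
          gcongr
      _ = √Real.pi * Real.exp 1 * (n + 1) * Real.exp (-(n + 1)) *
            Real.exp (2 * ρ * √(2 * n)) / 4 * Real.exp (-x ^ 2) *
            ((1 + x ^ 2) ^ (2 * k) * (2 * ((n : ℝ) + 1)) ^ (n + 1)) := by ring
      _ ≤ √Real.pi * Real.exp 1 * (n + 1) * Real.exp (-(n + 1)) *
            Real.exp (2 * ρ * √(2 * n)) / 4 * Real.exp (-x ^ 2) *
            (16 ^ k * ((n : ℝ) + 1) ^ (2 * k) * (x ^ 2) ^ (n + 1)) := by gcongr
      _ = √Real.pi * Real.exp 1 * 16 ^ k * (((n : ℝ) + 1) ^ (2 * k + 1) *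
            Real.exp (2 * ρ * √(2 * n)) * Real.exp (-(1 * (n + 1)))) / 4 *
            ((x ^ 2) ^ (n + 1) * Real.exp (-x ^ 2)) := by
          rw [one_mul]; ring
      _ ≤ 1 / 4 * w := by gcongr
      _ ≤ (8 * A + 2) * w := by linarith

/-- The pointwise asymptotic lower bound for the Hermite functions on the line `Im z = ρ`. -/
lemma tendsto_max_one_hermiteScale_div {ρ : ℝ} (hρ : 0 < ρ) (x : ℝ) :
    Tendsto (fun n : ℕ => max 1
      (hermiteScale ρ n / ‖hermiteFun (n + 1) (x + ρ * Complex.I)‖)) atTop (𝓝 1) := by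
  set q : ℕ → ℝ := fun n => 2 * ((n + 1 : ℕ) : ℝ) + 1 - x ^ 2 with hq
  have hqe : ∀ n : ℕ, q n = 2 * n + (3 - x ^ 2) := fun n => by simp only [hq]; push_cast; ring
  have h2n : Tendsto (fun n : ℕ => 2 * (n : ℝ)) atTop atTop :=
    tendsto_natCast_atTop_atTop.const_mul_atTop two_pos
  have hqt : Tendsto q atTop atTop := by
    simp only [funext hqe]
    exact tendsto_atTop_add_const_right _ _ h2n
  have hsq : Tendsto (fun n => √(q n)) atTop atTop := Real.tendsto_sqrt_atTop.comp hqt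
  have hs2n : Tendsto (fun n : ℕ => √(2 * (n : ℝ))) atTop atTop := Real.tendsto_sqrt_atTop.comp h2n
  have hdiff : Tendsto (fun n : ℕ => √(q n) - √(2 * n)) atTop (𝓝 0) := by
    have h1 : Tendsto (fun n : ℕ => (3 - x ^ 2) / (√(q n) + √(2 * n))) atTop (𝓝 0) :=
      tendsto_const_nhds.div_atTop (hsq.atTop_add_atTop hs2n)
    refine h1.congr' ?_
    filter_upwards [hqt.eventually_gt_atTop 0] with n hn
    have h2 : 0 < √(q n) := Real.sqrt_pos.mpr hn
    have h3 := Real.sq_sqrt hn.le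
    have h4 : √(2 * (n : ℝ)) ^ 2 = 2 * n := Real.sq_sqrt (by positivity)
    have h5 : 0 < √(q n) + √(2 * n) := by positivity
    rw [div_eq_iff h5.ne']
    have h6 : √(q n) ^ 2 - √(2 * (n : ℝ)) ^ 2 = 3 - x ^ 2 := by rw [h3, h4, hqe]; ring
    linear_combination -h6
  set θ : ℕ → ℝ := fun n => (1 - |x| * ρ ^ 2 / √(q n)) *
    (1 - Real.exp (-(2 * ρ * √(q n)))) ^ 2 * Real.exp (2 * ρ * (√(q n) - √(2 * n))) with hθ
  have hθ1 : Tendsto θ atTop (𝓝 1) := by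
    have t1 : Tendsto (fun n => 1 - |x| * ρ ^ 2 / √(q n)) atTop (𝓝 (1 - 0)) :=
      (tendsto_const_nhds.div_atTop hsq).const_sub 1
    have t2 : Tendsto (fun n => (1 - Real.exp (-(2 * ρ * √(q n)))) ^ 2) atTop
        (𝓝 ((1 - 0) ^ 2)) :=
      ((Real.tendsto_exp_neg_atTop_nhds_zero.comp
        (hsq.const_mul_atTop (by positivity : 0 < 2 * ρ))).const_sub 1).pow 2
    have t3 : Tendsto (fun n : ℕ => Real.exp (2 * ρ * (√(q n) - √(2 * n)))) atTop
        (𝓝 (Real.exp (2 * ρ * 0))) :=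
      (Real.continuous_exp.tendsto _).comp (hdiff.const_mul (2 * ρ))
    have := (t1.mul t2).mul t3
    have e : ((1 : ℝ) - 0) * (1 - 0) ^ 2 * Real.exp (2 * ρ * 0) = 1 := by simp
    rw [e] at this
    exact this
  have hbound : ∀ᶠ n in atTop,
      hermiteScale ρ n / ‖hermiteFun (n + 1) (x + ρ * Complex.I)‖ ≤ 1 / √(θ n) := by
    filter_upwards [hqt.eventually_gt_atTop 0, hθ1.eventually_const_lt one_pos] with n hn hθn
    have hmain := (soninFun_mul_sinh_sq_le (n + 1) (x := x) (Y := ρ)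
      (by simp only [hq] at hn; linarith) hρ.le).2
    have hid : hermiteScale ρ n ^ 2 * θ n = soninFun (n + 1) 0 *
        (1 - |x| * ρ ^ 2 / √(q n)) * Real.sinh (√(q n) * ρ) ^ 2 := by
      have e1 : Real.exp (2 * ρ * (√(q n) - √(2 * n))) * Real.exp (2 * ρ * √(2 * n)) =
          Real.exp (√(q n) * ρ) ^ 2 := by
        rw [← Real.exp_add, ← Real.exp_nat_mul]; congr 1; push_cast; ring
      have e2 : Real.exp (√(q n) * ρ) * Real.exp (-(2 * ρ * √(q n))) =
          Real.exp (-(√(q n) * ρ)) := by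
        rw [← Real.exp_add]; congr 1; ring
      rw [hermiteScale_sq, Real.sinh_eq, ← e2]
      simp only [hθ]
      linear_combination (soninFun (n + 1) 0 * (1 - |x| * ρ ^ 2 / √(q n)) *
        (1 - Real.exp (-(2 * ρ * √(q n)))) ^ 2 / 4) * e1
    have h1 : (hermiteScale ρ n * √(θ n)) ^ 2 ≤
        ‖hermiteFun (n + 1) (x + ρ * Complex.I)‖ ^ 2 := by
      rw [mul_pow, Real.sq_sqrt hθn.le, hid]
      exact hmain
    have h2 : hermiteScale ρ n * √(θ n) ≤ ‖hermiteFun (n + 1) (x + ρ * Complex.I)‖ :=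
      le_of_sq_le_sq h1 (norm_nonneg _)
    have hs := Real.sqrt_pos.mpr hθn
    have h3 : 0 < hermiteScale ρ n * √(θ n) := mul_pos (hermiteScale_pos ρ n) hs
    rw [div_le_div_iff₀ (h3.trans_le h2) hs]
    linarith
  have hup : Tendsto (fun n => max 1 (1 / √(θ n))) atTop (𝓝 1) := by
    have h1 : Tendsto (fun n => 1 / √(θ n)) atTop (𝓝 (1 / √1)) :=
      tendsto_const_nhds.div ((Real.continuous_sqrt.tendsto 1).comp hθ1) (by simp)
    have := (tendsto_const_nhds (x := (1 : ℝ))).max h1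
    simpa using this
  refine tendsto_of_tendsto_of_tendsto_of_le_of_le' tendsto_const_nhds hup
    (Eventually.of_forall fun n => le_max_left _ _) ?_
  filter_upwards [hbound] with n hn
  exact max_le_max_left 1 hn

/-! ### Convergence of the boundary integrals -/

lemma lineDensity_eq (f : ℂ → ℂ) (c x : ℝ) : lineDensity f c x =
    Real.exp (-(x ^ 2 - c ^ 2) / 2) * ‖f ((x : ℂ) + c * Complex.I)‖ := by
  rw [lineDensity, norm_mul, norm_cexp_neg_sq_div_two]

lemma integrable_lineDensity {f : ℂ → ℂ} {c C : ℝ} {k : ℕ}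
    (hcont : Continuous fun x : ℝ => f ((x : ℂ) + c * Complex.I))
    (hbd : ∀ x : ℝ, ‖f ((x : ℂ) + c * Complex.I)‖ ≤ C * (1 + x ^ 2) ^ k) :
    Integrable (lineDensity f c) := by
  obtain ⟨A, hA, hAk⟩ := exists_one_add_sq_pow_le k
  have hC : 0 ≤ C := by
    have := (norm_nonneg _).trans (hbd 0)
    simpa using this
  have hint := (integrable_exp_neg_mul_sq (b := 1 / 4) (by norm_num)).const_mul
    (Real.exp (c ^ 2 / 2) * C * A)
  refine hint.mono' ?_ (ae_of_all _ fun x => ?_)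
  · refine Continuous.aestronglyMeasurable ?_
    simp only [funext (lineDensity_eq f c)]
    have := hcont.norm
    fun_prop
  · have e : Real.exp (-(x ^ 2 - c ^ 2) / 2) * Real.exp (x ^ 2 / 4) =
        Real.exp (c ^ 2 / 2) * Real.exp (-(1 / 4) * x ^ 2) := by
      rw [← Real.exp_add, ← Real.exp_add]; congr 1; ring
    rw [lineDensity_eq, Real.norm_of_nonneg (by positivity)]
    calc Real.exp (-(x ^ 2 - c ^ 2) / 2) * ‖f ((x : ℂ) + c * Complex.I)‖
        ≤ Real.exp (-(x ^ 2 - c ^ 2) / 2) * (C * (A * Real.exp (x ^ 2 / 4))) := by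
          gcongr
          exact (hbd x).trans (by gcongr; exact hAk x)
      _ = _ := by linear_combination (C * A) * e

/-- The quotient `f / Hₙ₊₁` along a boundary line is integrable for large `n`, and its suitably
scaled integral is asymptotically at most that of `|exp(-z²/2) f(z)|`. -/
lemma exists_tendsto_integral_line {f : ℂ → ℂ} {ρ c C : ℝ} {k : ℕ} (hρ : 0 < ρ)
    (hc : c = ρ ∨ c = -ρ)
    (hcont : Continuous fun x : ℝ => f ((x : ℂ) + c * Complex.I))
    (hbd : ∀ x : ℝ, ‖f ((x : ℂ) + c * Complex.I)‖ ≤ C * (1 + x ^ 2) ^ k) :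
    ∃ J : ℕ → ℝ, Tendsto J atTop (𝓝 (∫ x, lineDensity f c x)) ∧ ∀ᶠ n : ℕ in atTop,
      Integrable (fun x : ℝ => f ((x : ℂ) + c * Complex.I) /
        (hermitePoly ℂ (n + 1)).eval ((x : ℂ) + c * Complex.I)) ∧
      hermiteScale ρ n * ∫ x : ℝ, ‖f ((x : ℂ) + c * Complex.I) /
        (hermitePoly ℂ (n + 1)).eval ((x : ℂ) + c * Complex.I)‖ ≤ J n := by
  have hC : 0 ≤ C := by
    have := (norm_nonneg _).trans (hbd 0)
    simpa using this
  have hcne : c ≠ 0 := by rcases hc with rfl | rfl <;> simp [hρ.ne']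
  have hsym : ∀ (n : ℕ) (x : ℝ), ‖hermiteFun n (x + c * Complex.I)‖ =
      ‖hermiteFun n (x + ρ * Complex.I)‖ := fun n x => by
    rcases hc with rfl | rfl
    · rfl
    · rw [← norm_hermiteFun_conj]
      congr 2
      simp
  have hHne : ∀ (n : ℕ) (x : ℝ), (hermitePoly ℂ n).eval ((x : ℂ) + c * Complex.I) ≠ 0 :=
    fun n x => eval_hermitePoly_ne_zero (by simpa using hcne) n
  have hune : ∀ (n : ℕ) (x : ℝ), 0 < ‖hermiteFun n (x + ρ * Complex.I)‖ := fun n x => by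
    rw [← hsym, norm_pos_iff, hermiteFun]
    exact mul_ne_zero (Complex.exp_ne_zero _) (hHne n x)
  obtain ⟨D, hD, hdom⟩ := exists_hermiteScale_mul_le hρ (k + 1)
  have hlint := integrable_lineDensity hcont hbd
  have hLnn : ∀ x, 0 ≤ lineDensity f c x := fun x => norm_nonneg _
  set R : ℕ → ℝ → ℝ := fun n x =>
    hermiteScale ρ n / ‖hermiteFun (n + 1) (x + ρ * Complex.I)‖ with hR
  have hRc : ∀ n, Continuous (R n) := fun n => by
    refine continuous_const.div ?_ fun x => (hune _ x).ne'
    have h1 : Continuous (hermiteFun (n + 1)) :=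
      continuous_iff_continuousAt.mpr fun z => (hasDerivAt_hermiteFun _ z).continuousAt
    exact (h1.comp (by fun_prop)).norm
  have hLc : Continuous (lineDensity f c) := by
    simp only [funext (lineDensity_eq f c)]
    have := hcont.norm
    fun_prop
  have hquot : ∀ (n : ℕ) (x : ℝ), hermiteScale ρ n * ‖f ((x : ℂ) + c * Complex.I) /
      (hermitePoly ℂ (n + 1)).eval ((x : ℂ) + c * Complex.I)‖ = lineDensity f c x * R n x :=
    fun n x => by
    simp only [hR]
    rw [← hsym, lineDensity, hermiteFun, norm_mul, norm_mul, norm_div]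
    have h1 : ‖Complex.exp (-((x : ℂ) + c * Complex.I) ^ 2 / 2)‖ ≠ 0 :=
      norm_ne_zero_iff.mpr (Complex.exp_ne_zero _)
    have h2 := norm_ne_zero_iff.mpr (hHne (n + 1) x)
    field_simp
  have hdom2 : ∀ᶠ n : ℕ in atTop, ∀ x, lineDensity f c x * R n x ≤
      C * D * Real.exp (c ^ 2 / 2) * (1 + x ^ 2)⁻¹ := by
    filter_upwards [hdom] with n hn x
    have h1 := hn x
    have h2 : R n x * ((1 + x ^ 2) ^ (k + 1) * Real.exp (-x ^ 2 / 2)) ≤ D := by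
      simp only [hR]
      rw [div_mul_eq_mul_div, div_le_iff₀ (hune _ x), ← mul_assoc]
      exact h1
    have hR0 : 0 ≤ R n x := div_nonneg (hermiteScale_pos ρ n).le (norm_nonneg _)
    rw [lineDensity_eq, ← div_eq_mul_inv, le_div_iff₀ (by positivity)]
    have e : Real.exp (-(x ^ 2 - c ^ 2) / 2) = Real.exp (c ^ 2 / 2) * Real.exp (-x ^ 2 / 2) := by
      rw [← Real.exp_add]; congr 1; ring
    calc Real.exp (-(x ^ 2 - c ^ 2) / 2) * ‖f ((x : ℂ) + c * Complex.I)‖ * R n x * (1 + x ^ 2)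
        ≤ Real.exp (-(x ^ 2 - c ^ 2) / 2) * (C * (1 + x ^ 2) ^ k) * R n x * (1 + x ^ 2) := by
          gcongr; exact hbd x
      _ = C * Real.exp (c ^ 2 / 2) *
            (R n x * ((1 + x ^ 2) ^ (k + 1) * Real.exp (-x ^ 2 / 2))) := by rw [e]; ring
      _ ≤ C * Real.exp (c ^ 2 / 2) * D := by gcongr
      _ = _ := by ring
  have hgint : Integrable fun x : ℝ => C * D * Real.exp (c ^ 2 / 2) * (1 + x ^ 2)⁻¹ :=
    integrable_inv_one_add_sq.const_mul _
  have hψc : ∀ n, Continuous fun x => lineDensity f c x * max 1 (R n x) := fun n =>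
    hLc.mul (continuous_const.max (hRc n))
  have hψb : ∀ᶠ n : ℕ in atTop, ∀ x, ‖lineDensity f c x * max 1 (R n x)‖ ≤
      lineDensity f c x + C * D * Real.exp (c ^ 2 / 2) * (1 + x ^ 2)⁻¹ := by
    filter_upwards [hdom2] with n hn x
    have h0 : 0 ≤ C * D * Real.exp (c ^ 2 / 2) * (1 + x ^ 2)⁻¹ := by positivity
    rw [Real.norm_of_nonneg (mul_nonneg (hLnn x) (zero_le_one.trans (le_max_left _ _)))]
    rcases max_cases 1 (R n x) with ⟨h, _⟩ | ⟨h, _⟩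
    · rw [h]; linarith
    · rw [h]; linarith [hn x, hLnn x]
  refine ⟨fun n => ∫ x, lineDensity f c x * max 1 (R n x), ?_, ?_⟩
  · refine tendsto_integral_filter_of_dominated_convergence _
      (Eventually.of_forall fun n => (hψc n).aestronglyMeasurable)
      (hψb.mono fun n hn => ae_of_all _ hn) (hlint.add hgint) (ae_of_all _ fun x => ?_)
    have := (tendsto_max_one_hermiteScale_div hρ x).const_mul (lineDensity f c x)
    rwa [mul_one] at this
  · filter_upwards [hψb, hdom2] with n hn hn2
    have hs := hermiteScale_pos ρ n
    have hqc : Continuous (fun x : ℝ => f ((x : ℂ) + c * Complex.I) /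
        (hermitePoly ℂ (n + 1)).eval ((x : ℂ) + c * Complex.I)) :=
      hcont.div ((hermitePoly ℂ (n + 1)).continuous.comp (by fun_prop)) fun x => hHne _ x
    have hLR : Integrable fun x => lineDensity f c x * R n x := by
      refine hgint.mono' (hLc.mul (hRc n)).aestronglyMeasurable (ae_of_all _ fun x => ?_)
      rw [Real.norm_of_nonneg (mul_nonneg (hLnn x) (div_nonneg hs.le (norm_nonneg _)))]
      exact hn2 x
    refine ⟨?_, ?_⟩
    · refine (integrable_norm_iff hqc.aestronglyMeasurable).mp ?_
      refine (hLR.const_mul (hermiteScale ρ n)⁻¹).congr (ae_of_all _ fun x => ?_)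
      simp only
      rw [← hquot, inv_mul_cancel_left₀ hs.ne']
    · rw [← integral_const_mul]
      simp only [hquot]
      refine integral_mono hLR ?_ fun x => ?_
      · exact (hlint.add hgint).mono' (hψc n).aestronglyMeasurable (ae_of_all _ hn)
      · exact mul_le_mul_of_nonneg_left (le_max_right _ _) (hLnn x)

/-! ### The contour integral for the interpolation error -/

/-- Division of a holomorphic function by its zeros. -/
lemma exists_differentiableOn_eq_mul_prod {U : Set ℂ} (hU : IsOpen U) (s : Finset ℂ)
    (hs : (s : Set ℂ) ⊆ U) {h : ℂ → ℂ} (hh : DifferentiableOn ℂ h U) (h0 : ∀ a ∈ s, h a = 0) :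
    ∃ g : ℂ → ℂ, DifferentiableOn ℂ g U ∧ ∀ z, h z = g z * ∏ a ∈ s, (z - a) := by
  classical
  induction s using Finset.induction_on with
  | empty => exact ⟨h, hh, fun z => by simp⟩
  | insert b s hb ih =>
    obtain ⟨g, hg, hgz⟩ := ih (fun a ha => hs (by simp_all))
      (fun a ha => h0 a (Finset.mem_insert_of_mem ha))
    have hgb : g b = 0 := by
      have h1 := h0 b (Finset.mem_insert_self b s)
      rw [hgz b] at h1
      refine (mul_eq_zero.mp h1).resolve_right (Finset.prod_ne_zero_iff.mpr fun a ha => ?_)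
      exact sub_ne_zero.mpr fun e => hb (e ▸ ha)
    refine ⟨dslope g b, (Complex.differentiableOn_dslope
      (hU.mem_nhds (hs (by simp)))).mpr hg, fun z => ?_⟩
    have h2 := sub_smul_dslope g b z
    rw [hgb, sub_zero, smul_eq_mul] at h2
    rw [hgz z, ← h2, Finset.prod_insert hb]
    ring

/-- The difference of the values of `g` on the lower and the upper boundary line of the strip. -/
noncomputable def lineDiff (ρ : ℝ) (g : ℂ → ℂ) (t : ℝ) : ℂ :=
  g ((t : ℂ) + ((-ρ : ℝ) : ℂ) * Complex.I) - g ((t : ℂ) + (ρ : ℂ) * Complex.I)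

lemma lineDiff_inv_sub {ρ : ℝ} (hρ : 0 < ρ) (a : ℝ) (t : ℝ) :
    lineDiff ρ (fun z => (z - a)⁻¹) t =
      ((2 * ρ⁻¹ * (1 + ((t - a) / ρ) ^ 2)⁻¹ : ℝ) : ℂ) * Complex.I := by
  have h1 : ∀ c : ℝ, c ≠ 0 → ((t : ℂ) + c * Complex.I - a) ≠ 0 := fun c hc h => by
    have := congrArg Complex.im h
    simp at this
    exact hc this
  have h2 := h1 ρ hρ.ne'
  have h3 := h1 (-ρ) (neg_ne_zero.mpr hρ.ne')
  have h4 : ((1 + ((t - a) / ρ) ^ 2 : ℝ) : ℂ) ≠ 0 := by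
    exact_mod_cast (by positivity : (1 + ((t - a) / ρ) ^ 2 : ℝ) ≠ 0)
  have h5 : ((t : ℂ) + ((-ρ : ℝ) : ℂ) * Complex.I - a) * ((t : ℂ) + ρ * Complex.I - a) =
      ρ ^ 2 * ((1 + ((t - a) / ρ) ^ 2 : ℝ) : ℂ) := by
    have hρ' : (ρ : ℂ) ≠ 0 := by exact_mod_cast hρ.ne'
    push_cast
    field_simp
    linear_combination (-(ρ : ℂ) ^ 2) * Complex.I_sq
  have hρ' : (ρ : ℂ) ≠ 0 := by exact_mod_cast hρ.ne'
  rw [lineDiff, inv_sub_inv h3 h2, h5]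
  push_cast at h4 ⊢
  field_simp
  ring

lemma integrable_lineDiff_inv_sub {ρ : ℝ} (hρ : 0 < ρ) (a : ℝ) :
    Integrable (lineDiff ρ fun z => (z - a)⁻¹) := by
  simp only [funext (lineDiff_inv_sub hρ a)]
  refine Integrable.mul_const ?_ _
  refine Integrable.ofReal ?_
  exact (((integrable_inv_one_add_sq.comp_div hρ.ne').comp_sub_right a)).const_mul _

lemma integral_lineDiff_inv_sub {ρ : ℝ} (hρ : 0 < ρ) (a : ℝ) :
    ∫ t, lineDiff ρ (fun z => (z - a)⁻¹) t = 2 * Real.pi * Complex.I := by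
  simp only [funext (lineDiff_inv_sub hρ a)]
  rw [integral_mul_const, integral_complex_ofReal, integral_const_mul,
    integral_sub_right_eq_self (fun t : ℝ => (1 + (t / ρ) ^ 2)⁻¹) a,
    Measure.integral_comp_div (fun t : ℝ => (1 + t ^ 2)⁻¹) ρ, integral_univ_inv_one_add_sq,
    abs_of_pos hρ, smul_eq_mul]
  congr 1
  push_cast
  have hρ' : (ρ : ℂ) ≠ 0 := by exact_mod_cast hρ.ne'
  field_simp

/-- Cauchy's theorem on the strip, for functions tending to zero along it. -/
lemma integral_lineDiff_eq_zero {ρ : ℝ} (hρ : 0 < ρ) {g : ℂ → ℂ}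
    (hg : DifferentiableOn ℂ g (strip ρ)) (hint : Integrable (lineDiff ρ g))
    {M : ℝ → ℝ} (hM : Tendsto M atTop (𝓝 0))
    (hgM : ∀ᶠ T in atTop, ∀ z ∈ strip ρ, |z.re| = T → ‖g z‖ ≤ M T) :
    ∫ t, lineDiff ρ g t = 0 := by
  have hlim := intervalIntegral_tendsto_integral hint tendsto_neg_atTop_atBot tendsto_id
  refine tendsto_nhds_unique hlim ?_
  rw [tendsto_zero_iff_norm_tendsto_zero]
  have hM2 : Tendsto (fun T => 4 * ρ * M T) atTop (𝓝 0) := by simpa using hM.const_mul (4 * ρ)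
  refine squeeze_zero' (Eventually.of_forall fun T => norm_nonneg _) ?_ hM2
  filter_upwards [hgM, eventually_gt_atTop 0] with T hT hT0
  have hrect : (Set.uIcc (-T) T ×ℂ Set.uIcc (-ρ) ρ) ⊆ strip ρ := fun z hz => by
    rw [Set.uIcc_of_le (by linarith : -ρ ≤ ρ)] at hz
    exact hz.2
  have hcauchy := Complex.integral_boundary_rect_eq_zero_of_differentiableOn g
    ((-T : ℝ) + ((-ρ : ℝ) : ℂ) * Complex.I) ((T : ℝ) + (ρ : ℂ) * Complex.I)
    (by simpa using hg.mono hrect)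
  simp only [Complex.add_re, Complex.ofReal_re, Complex.re_ofReal_mul, Complex.I_re, mul_zero,
    add_zero, Complex.add_im, Complex.ofReal_im, Complex.im_ofReal_mul, Complex.I_im, mul_one,
    zero_add] at hcauchy
  have hline : ∀ c ∈ Set.Icc (-ρ) ρ, IntervalIntegrable
      (fun t : ℝ => g ((t : ℂ) + (c : ℂ) * Complex.I)) volume (-T) T := fun c hc => by
    refine Continuous.intervalIntegrable ?_ _ _
    refine hg.continuousOn.comp_continuous (by fun_prop) fun t => ?_
    simpa [strip] using hc
  have hsub : ∫ t in (-T)..T, lineDiff ρ g t =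
      (∫ t : ℝ in (-T)..T, g ((t : ℂ) + ((-ρ : ℝ) : ℂ) * Complex.I)) -
        ∫ t : ℝ in (-T)..T, g ((t : ℂ) + (ρ : ℂ) * Complex.I) :=
    intervalIntegral.integral_sub (hline (-ρ) (by simp [hρ.le])) (hline ρ (by simp [hρ.le]))
  have hvert : ∀ c : ℝ, |c| = T →
      ‖∫ y : ℝ in (-ρ)..ρ, g ((c : ℂ) + y * Complex.I)‖ ≤ M T * (2 * ρ) := fun c hc => by
    have := intervalIntegral.norm_integral_le_of_norm_le_const (a := -ρ) (b := ρ) (C := M T)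
      (f := fun y : ℝ => g ((c : ℂ) + y * Complex.I)) fun y hy => by
        rw [Set.uIoc_of_le (by linarith)] at hy
        exact hT _ (by simp [strip, hy.1.le, hy.2]) (by simpa using hc)
    rwa [show |ρ - -ρ| = 2 * ρ by rw [sub_neg_eq_add, ← two_mul, abs_of_pos (by positivity)]]
      at this
  have h1 := hvert T (abs_of_pos hT0)
  have h2 := hvert (-T) (by rw [abs_neg, abs_of_pos hT0])
  have heq : ∫ t in (-T)..T, lineDiff ρ g t =
      Complex.I • (∫ y : ℝ in (-ρ)..ρ, g (((-T : ℝ) : ℂ) + y * Complex.I)) -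
        Complex.I • ∫ y : ℝ in (-ρ)..ρ, g ((T : ℂ) + y * Complex.I) := by
    rw [hsub]
    linear_combination hcauchy
  simp only [id]
  rw [heq]
  refine (norm_sub_le _ _).trans ?_
  rw [norm_smul, norm_smul, Complex.norm_I]
  linarith

/-- The error of Hermite interpolation is bounded by the integral of `|f / Hₙ₊₁|` over the boundary
of the strip, because `f - p` is `Hₙ₊₁` times the Cauchy integral of `f / Hₙ₊₁`. -/
lemma norm_sub_interpolant_le {f : ℂ → ℂ} {ρ C : ℝ} {k n : ℕ} {p : ℂ[X]} (hρ : 0 < ρ)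
    (hf : AnalyticOnNhd ℂ f (strip ρ))
    (hbd : ∀ z ∈ strip ρ, ‖f z‖ ≤ C * (1 + z.re ^ 2) ^ k) (hk : 2 * k ≤ n + 1)
    (hdeg : p.degree < (n + 1 : ℕ)) (hp : ∀ a ∈ hermiteNodes (n + 1), p.eval a = f a)
    (hI : ∀ c ∈ ({ρ, -ρ} : Set ℝ), Integrable (fun t : ℝ => f ((t : ℂ) + c * Complex.I) /
        (hermitePoly ℂ (n + 1)).eval ((t : ℂ) + c * Complex.I))) (x : ℝ) :
    2 * Real.pi * ρ * ‖f x - p.eval (x : ℂ)‖ ≤ |(hermitePoly ℝ (n + 1)).eval x| *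
      ((∫ t : ℝ, ‖f ((t : ℂ) + ρ * Complex.I) /
          (hermitePoly ℂ (n + 1)).eval ((t : ℂ) + ρ * Complex.I)‖) +
        ∫ t : ℝ, ‖f ((t : ℂ) + ((-ρ : ℝ) : ℂ) * Complex.I) /
          (hermitePoly ℂ (n + 1)).eval ((t : ℂ) + ((-ρ : ℝ) : ℂ) * Complex.I)‖) := by
  set s := hermiteNodes (n + 1) with hs
  set F : ℂ → ℂ := fun z => f z / (hermitePoly ℂ (n + 1)).eval z with hF
  have hIp : Integrable fun t : ℝ => F ((t : ℂ) + ρ * Complex.I) := hI ρ (by simp)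
  have hIm : Integrable fun t : ℝ => F ((t : ℂ) + ((-ρ : ℝ) : ℂ) * Complex.I) :=
    hI (-ρ) (by simp)
  have hx_strip : (x : ℂ) ∈ strip ρ := by simp [strip, hρ.le]
  have hreal : ∀ a ∈ s, a = (a.re : ℂ) := fun a ha =>
    Complex.ext rfl (by simpa using im_eq_zero_of_mem_hermiteNodes ha)
  by_cases hxs : (x : ℂ) ∈ s
  · rw [hp _ hxs, sub_self, norm_zero, mul_zero]
    positivity
  -- `f - p` is divisible by the nodal polynomial; the quotient is `g₀`.
  set U : Set ℂ := {z | AnalyticAt ℂ f z} with hUdef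
  have hU : IsOpen U := isOpen_analyticAt ℂ f
  have hSU : strip ρ ⊆ U := fun z hz => hf z hz
  have hsU : (s : Set ℂ) ⊆ U := fun a ha => hSU (by
    rw [hreal a ha]; simp [strip, hρ.le])
  have hfU : DifferentiableOn ℂ f U := fun z hz =>
    (AnalyticAt.differentiableAt hz).differentiableWithinAt
  obtain ⟨g₀, hg₀, hg₀z⟩ := exists_differentiableOn_eq_mul_prod hU s hsU
    (hfU.sub p.differentiable.differentiableOn) (fun a ha => sub_eq_zero.mpr (hp a ha).symm)
  have hg : DifferentiableOn ℂ (dslope g₀ x) (strip ρ) :=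
    ((Complex.differentiableOn_dslope (hU.mem_nhds (hSU hx_strip))).mpr hg₀).mono hSU
  have hHprod : ∀ z, (hermitePoly ℂ (n + 1)).eval z = 2 ^ (n + 1) * ∏ a ∈ s, (z - a) :=
    eval_hermitePoly_eq_prod (n + 1)
  have h2N : (2 : ℂ) ^ (n + 1) ≠ 0 := pow_ne_zero _ two_ne_zero
  have hHne : ∀ z, z ∉ s → (hermitePoly ℂ (n + 1)).eval z ≠ 0 := fun z hz =>
    fun h => hz (mem_hermiteNodes.mpr h)
  set r : ℂ → ℂ := fun a => Lagrange.nodalWeight s id a * p.eval a with hr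
  -- Partial fractions for `p` over the nodal polynomial.
  have hpart : ∀ z, z ∉ s → p.eval z / ∏ a ∈ s, (z - a) = ∑ a ∈ s, r a * (z - a)⁻¹ := by
    intro z hz
    have hne : ∏ a ∈ s, (z - a) ≠ 0 := Finset.prod_ne_zero_iff.mpr fun a ha =>
      sub_ne_zero.mpr fun e => hz (e ▸ ha)
    have h1 : p = Lagrange.interpolate s id fun a => p.eval a :=
      Lagrange.eq_interpolate (Set.injOn_id _) (by rw [hs, card_hermiteNodes]; exact hdeg)
    have h2 := Lagrange.eval_interpolate_not_at_node (s := s) (v := id) (x := z)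
      (fun a => p.eval a) (fun a ha e => hz (by rw [e]; exact ha))
    rw [← h1, Lagrange.eval_nodal] at h2
    rw [div_eq_iff hne, h2, mul_comm]
    congr 1
    refine Finset.sum_congr rfl fun a _ => ?_
    simp only [hr, id]
    ring
  have hgz : ∀ z, z ∉ s → z ≠ x → dslope g₀ x z =
      (2 ^ (n + 1) * F z - ∑ a ∈ s, r a * (z - a)⁻¹ - g₀ x) * (z - x)⁻¹ := by
    intro z hz hzx
    have hne : ∏ a ∈ s, (z - a) ≠ 0 := Finset.prod_ne_zero_iff.mpr fun a ha =>
      sub_ne_zero.mpr fun e => hz (e ▸ ha)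
    rw [dslope_of_ne _ hzx, slope_def_field, ← hpart z hz, div_eq_mul_inv]
    congr 2
    have h1 : g₀ z = (f z - p.eval z) / ∏ a ∈ s, (z - a) := by
      rw [eq_div_iff hne]
      exact (hg₀z z).symm
    rw [h1]
    simp only [hF]
    rw [hHprod z]
    field_simp
  have hnots : ∀ z : ℂ, z.im ≠ 0 → z ∉ s := fun z hz h =>
    hz (im_eq_zero_of_mem_hermiteNodes h)
  have hnotx : ∀ (y : ℝ) (z : ℂ), z.im ≠ 0 → z ≠ y := fun y z hz e => hz (by simp [e])
  set G : ℂ → ℂ := fun z => F z * (z - x)⁻¹ with hG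
  have him : ∀ c : ℝ, ∀ t : ℝ, ((t : ℂ) + (c : ℂ) * Complex.I).im = c := fun c t => by simp
  have hxa : ∀ a ∈ s, a - (x : ℂ) ≠ 0 := fun a ha => sub_ne_zero.mpr fun e => hxs (e ▸ ha)
  have hg_im : ∀ z : ℂ, z.im ≠ 0 → dslope g₀ x z = 2 ^ (n + 1) * G z -
      ∑ a ∈ s, r a * (a - x)⁻¹ * ((z - (a.re : ℂ))⁻¹ - (z - x)⁻¹) - g₀ x * (z - x)⁻¹ := by
    intro z hz
    rw [hgz z (hnots z hz) (hnotx x z hz), sub_mul, sub_mul, Finset.sum_mul, mul_assoc]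
    congr 2
    refine Finset.sum_congr rfl fun a ha => ?_
    rw [← hreal a ha]
    have h1 : z - a ≠ 0 := sub_ne_zero.mpr fun e => hnots z hz (e ▸ ha)
    have h2 : z - x ≠ 0 := sub_ne_zero.mpr (hnotx x z hz)
    have h3 := hxa a ha
    field_simp
    ring
  have hld : ∀ t, lineDiff ρ (dslope g₀ x) t = 2 ^ (n + 1) * lineDiff ρ G t -
      ∑ a ∈ s, r a * (a - x)⁻¹ * (lineDiff ρ (fun z => (z - (a.re : ℂ))⁻¹) t -
        lineDiff ρ (fun z => (z - (x : ℂ))⁻¹) t) -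
      g₀ x * lineDiff ρ (fun z => (z - (x : ℂ))⁻¹) t := by
    intro t
    simp only [lineDiff]
    rw [hg_im _ (by rw [him]; linarith), hg_im _ (by rw [him]; linarith)]
    have : ∀ A B A' B' : ℂ, ∀ u v u' v' : ℂ → ℂ,
        (2 ^ (n + 1) * A - ∑ a ∈ s, r a * (a - x)⁻¹ * (u a - v a) - B) -
        (2 ^ (n + 1) * A' - ∑ a ∈ s, r a * (a - x)⁻¹ * (u' a - v' a) - B') =
        2 ^ (n + 1) * (A - A') -
          ∑ a ∈ s, r a * (a - x)⁻¹ * ((u a - u' a) - (v a - v' a)) - (B - B') := by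
      intro A B A' B' u v u' v'
      have : ∑ a ∈ s, r a * (a - x)⁻¹ * ((u a - u' a) - (v a - v' a)) =
          ∑ a ∈ s, r a * (a - x)⁻¹ * (u a - v a) - ∑ a ∈ s, r a * (a - x)⁻¹ * (u' a - v' a) := by
        rw [← Finset.sum_sub_distrib]
        exact Finset.sum_congr rfl fun a _ => by ring
      rw [this]
      ring
    rw [mul_sub (g₀ x)]
    exact this _ _ _ _ (fun a => _) (fun a => _) (fun a => _) (fun a => _)
  have hinvbd : ∀ c : ℝ, |c| = ρ → ∀ t : ℝ, ‖((t : ℂ) + c * Complex.I - x)⁻¹‖ ≤ ρ⁻¹ := by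
    intro c hc t
    rw [norm_inv]
    refine inv_anti₀ hρ ?_
    have h1 := Complex.abs_im_le_norm ((t : ℂ) + c * Complex.I - x)
    have h2 : ((t : ℂ) + c * Complex.I - x).im = c := by simp
    rwa [h2, hc] at h1
  have hGint : ∀ c : ℝ, |c| = ρ → Integrable (fun t : ℝ => F ((t : ℂ) + c * Complex.I)) →
      Integrable (fun t : ℝ => G ((t : ℂ) + c * Complex.I)) ∧
      ‖∫ t : ℝ, G ((t : ℂ) + c * Complex.I)‖ ≤ ρ⁻¹ * ∫ t : ℝ, ‖F ((t : ℂ) + c * Complex.I)‖ := by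
    intro c hc hi
    have hcne : c ≠ 0 := fun h => by simp [h] at hc; linarith
    have hb : ∀ t : ℝ, ‖G ((t : ℂ) + c * Complex.I)‖ ≤ ρ⁻¹ * ‖F ((t : ℂ) + c * Complex.I)‖ :=
      fun t => by
      simp only [hG, norm_mul]
      rw [mul_comm]
      gcongr
      exact hinvbd c hc t
    refine ⟨(hi.norm.const_mul ρ⁻¹).mono' ?_ (ae_of_all _ hb), ?_⟩
    · refine hi.aestronglyMeasurable.mul (Continuous.aestronglyMeasurable ?_)
      refine Continuous.inv₀ (by fun_prop) fun t => ?_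
      exact sub_ne_zero.mpr (hnotx x _ (by rwa [him]))
    · rw [← integral_const_mul]
      exact norm_integral_le_of_norm_le (hi.norm.const_mul ρ⁻¹) (ae_of_all _ hb)
  obtain ⟨hGp, hGpb⟩ := hGint ρ (abs_of_pos hρ) hIp
  obtain ⟨hGm, hGmb⟩ := hGint (-ρ) (by rw [abs_neg, abs_of_pos hρ]) hIm
  have hLG : Integrable (lineDiff ρ G) := hGm.sub hGp
  have hLx := integrable_lineDiff_inv_sub hρ x
  have hLa : ∀ a ∈ s, Integrable fun t => r a * (a - x)⁻¹ *
      (lineDiff ρ (fun z => (z - (a.re : ℂ))⁻¹) t - lineDiff ρ (fun z => (z - (x : ℂ))⁻¹) t) :=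
    fun a _ => ((integrable_lineDiff_inv_sub hρ a.re).sub hLx).const_mul _
  have hLsum := integrable_finsetSum s hLa
  have hLint : Integrable (lineDiff ρ (dslope g₀ x)) := by
    rw [funext hld]
    exact ((hLG.const_mul _).sub hLsum).sub (hLx.const_mul _)
  have hint_eq : ∫ t, lineDiff ρ (dslope g₀ x) t =
      2 ^ (n + 1) * (∫ t, lineDiff ρ G t) - g₀ x * (2 * Real.pi * Complex.I) := by
    have hLA : Integrable fun t => 2 ^ (n + 1) * lineDiff ρ G t -
        ∑ a ∈ s, r a * (a - x)⁻¹ * (lineDiff ρ (fun z => (z - (a.re : ℂ))⁻¹) t -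
          lineDiff ρ (fun z => (z - (x : ℂ))⁻¹) t) := (hLG.const_mul _).sub hLsum
    simp only [hld]
    rw [integral_sub hLA (hLx.const_mul _), integral_sub (hLG.const_mul _) hLsum,
      integral_finsetSum _ hLa, integral_const_mul,
      integral_const_mul, integral_lineDiff_inv_sub hρ x]
    have : ∀ a ∈ s, ∫ t, r a * (a - x)⁻¹ * (lineDiff ρ (fun z => (z - (a.re : ℂ))⁻¹) t -
        lineDiff ρ (fun z => (z - (x : ℂ))⁻¹) t) = 0 := fun a _ => by
      rw [integral_const_mul, integral_sub (integrable_lineDiff_inv_sub hρ a.re) hLx,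
        integral_lineDiff_inv_sub hρ, integral_lineDiff_inv_sub hρ, sub_self, mul_zero]
    rw [Finset.sum_eq_zero this, sub_zero]
  -- For `2 k ≤ n + 1` the growth of `f` is at most that of `Hₙ₊₁`, so the factor `1 / (z - x)` makes
  -- the divided difference tend to zero along the strip.
  have hC : 0 ≤ C := by
    have := (norm_nonneg _).trans (hbd 0 (by simp [strip, hρ.le]))
    simpa using this
  set B : ℝ := 2 ^ (n + 1) * (C * 2 ^ k) + ∑ a ∈ s, ‖r a‖ + ‖g₀ x‖ with hB
  have hMlim : Tendsto (fun T : ℝ => B * (T - |x|)⁻¹) atTop (𝓝 0) := by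
    have := (tendsto_inv_atTop_zero.comp (tendsto_atTop_add_const_right atTop (-|x|)
      tendsto_id)).const_mul B
    simpa [Function.comp_def, sub_eq_add_neg] using this
  have hdecay : ∀ᶠ T in atTop, ∀ z ∈ strip ρ, |z.re| = T →
      ‖dslope g₀ x z‖ ≤ B * (T - |x|)⁻¹ := by
    have hnodes : ∀ᶠ T : ℝ in atTop, ∀ a ∈ s, |a.re| + 1 ≤ T :=
      (Filter.eventually_all_finset s).mpr fun a _ => eventually_ge_atTop _
    filter_upwards [hnodes, eventually_gt_atTop |x|, eventually_ge_atTop 1,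
      eventually_ge_atTop (2 * ((n + 1 : ℕ) : ℝ))] with T hTs hTx hT1 hTN z hz hzT
    have hzs : z ∉ s := fun h => by
      have := hTs z h
      linarith
    have hzx : z ≠ x := fun e => by
      rw [e, Complex.ofReal_re] at hzT
      linarith
    have hzn : T ≤ ‖z‖ := hzT ▸ Complex.abs_re_le_norm z
    have hFz : ‖F z‖ ≤ C * 2 ^ k := by
      have h1 : T ^ (n + 1) ≤ ‖(hermitePoly ℂ (n + 1)).eval z‖ :=
        (pow_le_pow_left₀ (by linarith) hzn _).trans
          (norm_pow_le_norm_hermitePoly (by nlinarith))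
      have h2 : ‖f z‖ ≤ C * 2 ^ k * T ^ (n + 1) := by
        have e : z.re ^ 2 = T ^ 2 := by rw [← hzT, sq_abs]
        refine (hbd z hz).trans ?_
        rw [e, mul_assoc]
        gcongr
        calc (1 + T ^ 2) ^ k ≤ (2 * T ^ 2) ^ k := by gcongr; nlinarith
          _ = 2 ^ k * T ^ (2 * k) := by rw [mul_pow, ← pow_mul]
          _ ≤ 2 ^ k * T ^ (n + 1) := by gcongr
      simp only [hF, norm_div]
      rw [div_le_iff₀ (norm_pos_iff.mpr (hHne z hzs))]
      refine h2.trans ?_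
      gcongr
    have hsum : ‖∑ a ∈ s, r a * (z - a)⁻¹‖ ≤ ∑ a ∈ s, ‖r a‖ := by
      refine norm_sum_le_of_le _ fun a ha => ?_
      rw [norm_mul, norm_inv]
      refine mul_le_of_le_one_right (norm_nonneg _) (inv_le_one_of_one_le₀ ?_)
      have h1 := Complex.abs_re_le_norm (z - a)
      have h2 := abs_sub_abs_le_abs_sub z.re a.re
      rw [Complex.sub_re] at h1
      linarith [hTs a ha]
    have hzxn : T - |x| ≤ ‖z - x‖ := by
      have h1 := Complex.abs_re_le_norm (z - x)
      have h2 := abs_sub_abs_le_abs_sub z.re x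
      rw [Complex.sub_re, Complex.ofReal_re] at h1
      linarith
    rw [hgz z hzs hzx, norm_mul, norm_inv]
    have hnum : ‖2 ^ (n + 1) * F z - ∑ a ∈ s, r a * (z - a)⁻¹ - g₀ x‖ ≤ B := by
      refine (norm_sub_le _ _).trans (add_le_add ((norm_sub_le _ _).trans (add_le_add ?_ hsum))
        le_rfl)
      rw [norm_mul, norm_pow, Complex.norm_ofNat]
      gcongr
    have : 0 < T - |x| := by linarith
    gcongr
  have hzero := integral_lineDiff_eq_zero hρ hg hLint hMlim hdecay
  rw [hint_eq, sub_eq_zero] at hzero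
  -- The Cauchy integral formula for the interpolation error.
  have hformula : (2 * Real.pi * Complex.I) * (f x - p.eval (x : ℂ)) =
      (hermitePoly ℂ (n + 1)).eval (x : ℂ) * ∫ t, lineDiff ρ G t := by
    have h1 := hg₀z x
    simp only [Pi.sub_apply] at h1
    rw [h1, hHprod]
    linear_combination (-∏ a ∈ s, ((x : ℂ) - a)) * hzero
  have hnorm := congrArg norm hformula
  have e1 : ‖(2 * Real.pi * Complex.I : ℂ)‖ = 2 * Real.pi := by
    simp [abs_of_pos Real.pi_pos]
  rw [norm_mul (2 * (Real.pi : ℂ) * Complex.I), e1, norm_mul, eval_ofReal_hermitePoly,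
    Complex.norm_real, Real.norm_eq_abs]
    at hnorm
  have hLGn : ‖∫ t, lineDiff ρ G t‖ ≤ ρ⁻¹ * ((∫ t : ℝ, ‖F ((t : ℂ) + ρ * Complex.I)‖) +
      ∫ t : ℝ, ‖F ((t : ℂ) + ((-ρ : ℝ) : ℂ) * Complex.I)‖) := by
    have : ∫ t, lineDiff ρ G t = (∫ t : ℝ, G ((t : ℂ) + ((-ρ : ℝ) : ℂ) * Complex.I)) -
        ∫ t : ℝ, G ((t : ℂ) + ρ * Complex.I) := integral_sub hGm hGp
    rw [this]
    refine (norm_sub_le _ _).trans ?_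
    linarith
  calc 2 * Real.pi * ρ * ‖f x - p.eval (x : ℂ)‖
      = ρ * (|(hermitePoly ℝ (n + 1)).eval x| * ‖∫ t, lineDiff ρ G t‖) := by
        rw [← hnorm]; ring
    _ ≤ ρ * (|(hermitePoly ℝ (n + 1)).eval x| * (ρ⁻¹ *
          ((∫ t : ℝ, ‖F ((t : ℂ) + ρ * Complex.I)‖) +
            ∫ t : ℝ, ‖F ((t : ℂ) + ((-ρ : ℝ) : ℂ) * Complex.I)‖))) := by gcongr
    _ = _ := by
        have e : ∀ A B : ℝ, ρ * (A * (ρ⁻¹ * B)) = A * B := fun A B => by field_simp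
        rw [e]

/-! ### Norms, interpolants and the growth condition -/

lemma eLpNorm_hermitePoly (n : ℕ) :
    eLpNorm (fun x : ℝ => (hermitePoly ℝ n).eval x) 2 weightMeasure =
      ENNReal.ofReal √(√Real.pi * 2 ^ n * n.factorial) := by
  have hmw : Measurable fun x => ENNReal.ofReal (weight x) := by
    unfold weight
    fun_prop
  have hc : Continuous fun x : ℝ => (hermitePoly ℝ n).eval x := (hermitePoly ℝ n).continuous
  rw [eLpNorm_eq_lintegral_rpow_enorm_toReal two_ne_zero ENNReal.ofNat_ne_top]
  have h1 : ∫⁻ x, ‖(hermitePoly ℝ n).eval x‖ₑ ^ (ENNReal.toReal 2) ∂weightMeasure =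
      ENNReal.ofReal (√Real.pi * 2 ^ n * n.factorial) := by
    rw [weightMeasure, lintegral_withDensity_eq_lintegral_mul _ hmw
      (by have := hc.measurable; fun_prop), ← integral_sq_hermitePoly_mul_weight,
      ofReal_integral_eq_lintegral_ofReal]
    · refine lintegral_congr fun x => ?_
      simp only [Pi.mul_apply]
      rw [ENNReal.ofReal_mul (sq_nonneg _), mul_comm, ENNReal.toReal_ofNat, ENNReal.rpow_ofNat,
        Real.enorm_eq_ofReal_abs, ← ENNReal.ofReal_pow (abs_nonneg _), sq_abs]
    · refine (integrable_eval_mul_weight (hermitePoly ℝ n ^ 2)).congr (ae_of_all _ fun x => ?_)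
      simp
    · exact ae_of_all _ fun x => mul_nonneg (sq_nonneg _) (weight_pos x).le
  rw [h1, ENNReal.toReal_ofNat, ENNReal.ofReal_rpow_of_nonneg (by positivity) (by norm_num),
    ← Real.sqrt_eq_rpow]

lemma eLpNorm_ne_top_of_le_exp {h : ℝ → ℂ} {D : ℝ}
    (hb : ∀ x, ‖h x‖ ≤ D * Real.exp (x ^ 2 / 4)) : eLpNorm h 2 weightMeasure ≠ ⊤ := by
  have hmw : Measurable fun x => ENNReal.ofReal (weight x) := by
    unfold weight
    fun_prop
  have hD : 0 ≤ D := by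
    have := (norm_nonneg _).trans (hb 0)
    simpa using this
  refine ne_top_of_le_ne_top ?_ (eLpNorm_mono_real hb)
  rw [eLpNorm_eq_lintegral_rpow_enorm_toReal two_ne_zero ENNReal.ofNat_ne_top]
  refine ENNReal.rpow_ne_top_of_nonneg (by simp) ?_
  rw [weightMeasure, lintegral_withDensity_eq_lintegral_mul _ hmw (by fun_prop)]
  have hi : Integrable fun x : ℝ => D ^ 2 * Real.exp (-(1 / 2) * x ^ 2) :=
    (integrable_exp_neg_mul_sq (by norm_num)).const_mul _
  refine ne_of_lt (lt_of_le_of_lt (le_of_eq (lintegral_congr fun x => ?_))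
    hi.lintegral_lt_top)
  simp only [Pi.mul_apply]
  rw [ENNReal.toReal_ofNat, ENNReal.rpow_ofNat, Real.enorm_eq_ofReal_abs,
    ← ENNReal.ofReal_pow (abs_nonneg _), sq_abs, ← ENNReal.ofReal_mul (weight_pos x).le, weight]
  congr 1
  rw [mul_pow, ← Real.exp_nat_mul, mul_left_comm, ← Real.exp_add]
  congr 2
  push_cast
  ring

lemma exists_norm_eval_le_exp (p : ℂ[X]) :
    ∃ D : ℝ, ∀ x : ℝ, ‖p.eval (x : ℂ)‖ ≤ D * Real.exp (x ^ 2 / 4) := by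
  induction p using Polynomial.induction_on' with
  | add p q hp hq =>
    obtain ⟨D, hD⟩ := hp
    obtain ⟨E, hE⟩ := hq
    refine ⟨D + E, fun x => ?_⟩
    rw [eval_add, add_mul]
    exact (norm_add_le _ _).trans (add_le_add (hD x) (hE x))
  | monomial m a =>
    obtain ⟨A, hA, hAm⟩ := exists_one_add_sq_pow_le m
    refine ⟨‖a‖ * A, fun x => ?_⟩
    have h1 : |x| ^ m ≤ (1 + x ^ 2) ^ m := by
      gcongr
      nlinarith [sq_abs x, sq_nonneg (|x| - 1)]
    rw [eval_monomial, norm_mul, norm_pow, Complex.norm_real, Real.norm_eq_abs, mul_assoc]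
    gcongr
    exact h1.trans (hAm x)

/-- A function on the strip with a power growth condition at infinity is bounded on the whole strip
by an integral power of `1 + (Re z)²`. -/
lemma exists_norm_le_one_add_sq_pow {f : ℂ → ℂ} {ρ σ : ℝ}
    (hf : AnalyticOnNhd ℂ f (strip ρ))
    (hgrowth : ∃ C R : ℝ, ∀ z ∈ strip ρ, R ≤ ‖z‖ → ‖f z‖ ≤ C * ‖z‖ ^ σ) :
    ∃ (C : ℝ) (k : ℕ), ∀ z ∈ strip ρ, ‖f z‖ ≤ C * (1 + z.re ^ 2) ^ k := by
  obtain ⟨C, R, hCR⟩ := hgrowth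
  obtain ⟨k, hk⟩ := exists_nat_ge σ
  have hclosed : IsClosed (strip ρ) := isClosed_Icc.preimage Complex.continuous_im
  have hcomp : IsCompact (strip ρ ∩ Metric.closedBall 0 (max R 1)) :=
    (isCompact_closedBall _ _).inter_left hclosed
  obtain ⟨M, hM⟩ := hcomp.exists_bound_of_continuousOn (hf.continuousOn.mono Set.inter_subset_left)
  refine ⟨max M 0 + |C| * (1 + ρ ^ 2) ^ k, k, fun z hz => ?_⟩
  have h1 : (1 : ℝ) ≤ (1 + z.re ^ 2) ^ k := one_le_pow₀ (by nlinarith [sq_nonneg z.re])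
  have h0 : 0 ≤ |C| * (1 + ρ ^ 2) ^ k := by positivity
  rcases le_or_gt ‖z‖ (max R 1) with h | h
  · have h2 := hM z ⟨hz, by simpa using h⟩
    have h3 : M ≤ max M 0 + |C| * (1 + ρ ^ 2) ^ k := by linarith [le_max_left M 0]
    have h4 : 0 ≤ max M 0 + |C| * (1 + ρ ^ 2) ^ k := by linarith [le_max_right M 0]
    exact (h2.trans h3).trans (le_mul_of_one_le_right h4 h1)
  · have hz1 : 1 ≤ ‖z‖ := (le_max_right R 1).trans h.le
    have h2 := hCR z hz ((le_max_left R 1).trans h.le)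
    have him : z.im ^ 2 ≤ ρ ^ 2 := sq_le_sq' hz.1 hz.2
    have hn : ‖z‖ ^ 2 = z.re ^ 2 + z.im ^ 2 := by
      rw [← Complex.normSq_eq_norm_sq, Complex.normSq_apply]; ring
    have h3 : ‖z‖ ≤ (1 + ρ ^ 2) * (1 + z.re ^ 2) := by
      nlinarith [sq_nonneg z.re, sq_nonneg ρ, mul_nonneg (sq_nonneg z.re) (sq_nonneg ρ)]
    calc ‖f z‖ ≤ C * ‖z‖ ^ σ := h2
      _ ≤ |C| * ‖z‖ ^ σ := by gcongr; exact le_abs_self C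
      _ ≤ |C| * ‖z‖ ^ (k : ℝ) := by gcongr
      _ = |C| * ‖z‖ ^ k := by rw [Real.rpow_natCast]
      _ ≤ |C| * ((1 + ρ ^ 2) * (1 + z.re ^ 2)) ^ k := by gcongr
      _ = |C| * (1 + ρ ^ 2) ^ k * (1 + z.re ^ 2) ^ k := by rw [mul_pow]; ring
      _ ≤ _ := by
        gcongr
        linarith [le_max_right M 0]

lemma isHermiteInterpolant_iff {f : ℂ → ℂ} {n : ℕ} {p : ℂ[X]} : IsHermiteInterpolant f n p ↔
    p.degree < (n + 1 : ℕ) ∧ ∀ a ∈ hermiteNodes (n + 1), p.eval a = f a := by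
  have hd : p.degree ≤ n ↔ p.degree < (n + 1 : ℕ) := by
    rw [degree_lt_iff_coeff_zero, degree_le_iff_coeff_zero]
    constructor
    · intro h m hm
      exact h m (by exact_mod_cast hm)
    · intro h m hm
      exact h m (by exact_mod_cast hm)
  rw [IsHermiteInterpolant, hd]
  refine and_congr_right fun _ => ⟨fun h a ha => ?_, fun h x hx => ?_⟩
  · have hre : a = (a.re : ℂ) :=
      Complex.ext rfl (by simpa using im_eq_zero_of_mem_hermiteNodes ha)
    rw [hre]
    refine h a.re ?_
    have h1 := mem_hermiteNodes.mp ha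
    rw [hre, eval_ofReal_hermitePoly] at h1
    rw [hermiteH_eq_eval]
    exact_mod_cast h1
  · refine h x (mem_hermiteNodes.mpr ?_)
    rw [eval_ofReal_hermitePoly, ← hermiteH_eq_eval, hx, Complex.ofReal_zero]

/-- Existence and uniqueness hold because `Hₙ₊₁` has exactly `n + 1` zeros, all of them real. -/
lemma existsUnique_isHermiteInterpolant (f : ℂ → ℂ) (n : ℕ) :
    ∃! p : ℂ[X], IsHermiteInterpolant f n p := by
  have h : ∀ p : ℂ[X], IsHermiteInterpolant f n p ↔
      p = Lagrange.interpolate (hermiteNodes (n + 1)) id f := fun p => by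
    have := Lagrange.eq_interpolate_iff (s := hermiteNodes (n + 1)) (r := f) (f := p)
      (Set.injOn_id _)
    rw [card_hermiteNodes] at this
    exact isHermiteInterpolant_iff.trans this
  exact ⟨_, (h _).mpr rfl, fun q hq => (h q).mp hq⟩

end HermiteInterp

open HermiteInterp

theorem mainTheorem5 (f : ℂ → ℂ) (ρ σ : ℝ) (hρ : 0 < ρ)
    (hf : AnalyticOnNhd ℂ f (HermiteInterp.strip ρ))
    (hgrowth : ∃ C R : ℝ, ∀ z ∈ HermiteInterp.strip ρ, R ≤ ‖z‖ → ‖f z‖ ≤ C * ‖z‖ ^ σ) :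
    Integrable (HermiteInterp.lineDensity f ρ) ∧
    Integrable (HermiteInterp.lineDensity f (-ρ)) ∧
    ∃ K : ℕ → ℝ,
      Tendsto K atTop
        (𝓝 (HermiteInterp.boundaryV f ρ / ((2 : ℝ) ^ (1 / 4 : ℝ) * ρ * √Real.pi))) ∧
      ∀ n : ℕ, max ⌊σ⌋ 1 ≤ (n : ℤ) →
        (∃! p : Polynomial ℂ, HermiteInterp.IsHermiteInterpolant f n p) ∧
        ∀ p : Polynomial ℂ, HermiteInterp.IsHermiteInterpolant f n p →
          eLpNorm (fun x : ℝ => f x - p.eval (x : ℂ)) 2 HermiteInterp.weightMeasure ≤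
            ENNReal.ofReal (K n * (n : ℝ) ^ (1 / 4 : ℝ) * Real.exp (-ρ * √(2 * n))) := by
  obtain ⟨C, k, hbd⟩ := exists_norm_le_one_add_sq_pow hf hgrowth
  have hline : ∀ c ∈ Set.Icc (-ρ) ρ, ∀ x : ℝ, ((x : ℂ) + c * Complex.I) ∈ strip ρ :=
    fun c hc x => by simpa [strip] using hc
  have hcont : ∀ c ∈ Set.Icc (-ρ) ρ, Continuous fun x : ℝ => f ((x : ℂ) + c * Complex.I) :=
    fun c hc => hf.continuousOn.comp_continuous (by fun_prop) (hline c hc)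
  have hbdl : ∀ c ∈ Set.Icc (-ρ) ρ, ∀ x : ℝ,
      ‖f ((x : ℂ) + c * Complex.I)‖ ≤ C * (1 + x ^ 2) ^ k := fun c hc x => by
    simpa using hbd _ (hline c hc x)
  have hρm : ρ ∈ Set.Icc (-ρ) ρ := ⟨by linarith, le_rfl⟩
  have hρm' : -ρ ∈ Set.Icc (-ρ) ρ := ⟨le_rfl, by linarith⟩
  refine ⟨integrable_lineDensity (hcont ρ hρm) (hbdl ρ hρm),
    integrable_lineDensity (hcont (-ρ) hρm') (hbdl (-ρ) hρm'), ?_⟩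
  obtain ⟨J, hJ, hJb⟩ := exists_tendsto_integral_line hρ (Or.inl rfl) (hcont ρ hρm) (hbdl ρ hρm)
  obtain ⟨J', hJ', hJb'⟩ :=
    exists_tendsto_integral_line hρ (Or.inr rfl) (hcont (-ρ) hρm') (hbdl (-ρ) hρm')
  -- For the finitely many degrees below `n₀` the constant is read off from the error itself.
  set q : ℕ → Polynomial ℂ := fun n => (existsUnique_isHermiteInterpolant f n).choose with hq
  have hqu : ∀ n p, IsHermiteInterpolant f n p → p = q n := fun n p hp =>
    (existsUnique_isHermiteInterpolant f n).choose_spec.2 p hp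
  set err : ℕ → ENNReal := fun n =>
    eLpNorm (fun x : ℝ => f x - (q n).eval (x : ℂ)) 2 weightMeasure with herr
  have herr_top : ∀ n, err n ≠ ⊤ := fun n => by
    obtain ⟨A, hA, hAk⟩ := exists_one_add_sq_pow_le k
    obtain ⟨D, hD⟩ := exists_norm_eval_le_exp (q n)
    have hC : 0 ≤ C := by
      have := (norm_nonneg _).trans (hbdl ρ hρm 0)
      simpa using this
    refine eLpNorm_ne_top_of_le_exp (D := C * A + D) fun x => ?_
    have h1 := hbdl 0 ⟨by linarith, hρ.le⟩ x
    simp only [Complex.ofReal_zero, zero_mul, add_zero] at h1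
    rw [add_mul, mul_assoc]
    refine (norm_sub_le _ _).trans (add_le_add (h1.trans ?_) (hD x))
    gcongr
    exact hAk x
  have hev := (hJb.and hJb').and (eventually_ge_atTop (2 * k))
  obtain ⟨n₀, hn₀⟩ := eventually_atTop.mp hev
  set B : ℕ → ℝ := fun n =>
    1 / (Real.pi * ρ) * (√(amplitudeRatio (n + 1)) / (n : ℝ) ^ (1 / 4 : ℝ)) * (J n + J' n) with hB
  refine ⟨fun n => if n < n₀ then
    (err n).toReal / ((n : ℝ) ^ (1 / 4 : ℝ) * Real.exp (-ρ * √(2 * n))) else B n, ?_, ?_⟩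
  · have h1 : Tendsto B atTop (𝓝 (1 / (Real.pi * ρ) * (√Real.pi / 2 ^ (1 / 4 : ℝ)) *
        boundaryV f ρ)) := (tendsto_sqrt_amplitudeRatio.const_mul _).mul (hJ.add hJ')
    have e : 1 / (Real.pi * ρ) * (√Real.pi / 2 ^ (1 / 4 : ℝ)) * boundaryV f ρ =
        boundaryV f ρ / ((2 : ℝ) ^ (1 / 4 : ℝ) * ρ * √Real.pi) := by
      have hpi : √Real.pi ^ 2 = Real.pi := Real.sq_sqrt Real.pi_pos.le
      have hpi0 : 0 < √Real.pi := Real.sqrt_pos.mpr Real.pi_pos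
      have h2 : (0 : ℝ) < 2 ^ (1 / 4 : ℝ) := by positivity
      nth_rewrite 1 [← hpi]
      generalize (2 : ℝ) ^ (1 / 4 : ℝ) = c at h2 ⊢
      generalize √Real.pi = d at hpi0 ⊢
      field_simp
    rw [← e]
    refine h1.congr' ?_
    filter_upwards [eventually_ge_atTop n₀] with n hn
    rw [if_neg (not_lt.mpr hn)]
  · intro n hn
    have hn1 : (1 : ℝ) ≤ n := by
      have := (le_max_right ⌊σ⌋ 1).trans hn
      exact_mod_cast this
    have hn4 : 0 < (n : ℝ) ^ (1 / 4 : ℝ) := Real.rpow_pos_of_pos (by linarith) _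
    refine ⟨existsUnique_isHermiteInterpolant f n, fun p hp => ?_⟩
    simp only
    split_ifs with hlt
    · rw [hqu n p hp, mul_assoc, div_mul_cancel₀ _ (by positivity)]
      rw [ENNReal.ofReal_toReal (herr_top n)]
    · obtain ⟨⟨⟨hI, hb⟩, hI', hb'⟩, hk⟩ := hn₀ n (not_lt.mp hlt)
      obtain ⟨hdeg, hpe⟩ := isHermiteInterpolant_iff.mp hp
      have hpt := norm_sub_interpolant_le hρ hf hbd (by omega : 2 * k ≤ n + 1) hdeg hpe
        (by rintro c (rfl | rfl); exacts [hI, hI'])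
      set I₁ := ∫ t : ℝ, ‖f ((t : ℂ) + ρ * Complex.I) /
          (hermitePoly ℂ (n + 1)).eval ((t : ℂ) + ρ * Complex.I)‖
      set I₂ := ∫ t : ℝ, ‖f ((t : ℂ) + ((-ρ : ℝ) : ℂ) * Complex.I) /
          (hermitePoly ℂ (n + 1)).eval ((t : ℂ) + ((-ρ : ℝ) : ℂ) * Complex.I)‖
      have hs := hermiteScale_pos ρ n
      have hS := Real.sqrt_pos.mpr (soninFun_zero_pos (n + 1))
      set Q : ℝ := (J n + J' n) / (2 * Real.pi * ρ * hermiteScale ρ n) with hQ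
      have hptQ : ∀ x : ℝ, ‖f x - p.eval (x : ℂ)‖ ≤ Q * ‖(hermitePoly ℝ (n + 1)).eval x‖ := by
        intro x
        rw [hQ, div_mul_eq_mul_div, le_div_iff₀ (by have := Real.pi_pos; positivity)]
        calc ‖f x - p.eval (x : ℂ)‖ * (2 * Real.pi * ρ * hermiteScale ρ n)
            = hermiteScale ρ n * (2 * Real.pi * ρ * ‖f x - p.eval (x : ℂ)‖) := by ring
          _ ≤ hermiteScale ρ n * (|(hermitePoly ℝ (n + 1)).eval x| * (I₁ + I₂)) := by
              exact mul_le_mul_of_nonneg_left (hpt x) hs.le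
          _ = (hermiteScale ρ n * I₁ + hermiteScale ρ n * I₂) *
                ‖(hermitePoly ℝ (n + 1)).eval x‖ := by rw [Real.norm_eq_abs]; ring
          _ ≤ (J n + J' n) * ‖(hermitePoly ℝ (n + 1)).eval x‖ := by gcongr
      refine (eLpNorm_le_mul_eLpNorm_of_ae_le_mul (ae_of_all _ hptQ) 2).trans ?_
      rw [eLpNorm_hermitePoly, ← ENNReal.ofReal_mul' (Real.sqrt_nonneg _)]
      refine ENNReal.ofReal_le_ofReal (le_of_eq ?_)
      simp only [hB, hQ, hermiteScale, amplitudeRatio]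
      rw [Real.sqrt_div' _ (soninFun_zero_nonneg _), neg_mul, Real.exp_neg]
      have hpi := Real.pi_pos
      have hexp := Real.exp_pos (ρ * √(2 * (n : ℝ)))
      generalize √(√Real.pi * 2 ^ (n + 1) * ((n + 1).factorial : ℝ)) = a
      generalize (n : ℝ) ^ (1 / 4 : ℝ) = b at hn4 ⊢
      field_simp
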